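/- Let $d\ge 1$, let $|\cdot|$ be any norm on $\mathbb R^d$, let $\lambda_d$ be the Lebesgue measure, let $p>0$, and let $X:\Omega\to\mathbb R^d$ be a random vector with law $\mu$. For $r>0$ and $\Gamma\subset\mathbb R^d$ put $e_r(\Gamma,X)=\big(\mathbb E\, d(X,\Gamma)^r\big)^{1/r}$, where $d(\xi,\Gamma)=\inf_{a\in\Gamma}|\xi-a|$. For a sequence $(a_N)_{N\ge1}$ in $\mathbb R^d$ put $a^{(N)}=\{a_1,\dots,a_N\}$ and $a^{(0)}=\emptyset$. The sequence is called $L^p$-optimal greedy for $X$ if $a_{N+1}\in\operatorname{argmin}_{\xi\in\mathbb R^d}e_p(a^{(N)}\cup\{\xi\},X)$ for every $N\ge0$, and $L^q$-rate optimal if $\limsup_{N}N^{1/d}e_q(a^{(N)},X)<+\infty$. (a) Let $q>0$. Suppose that $X\in L^{p+\delta}(\mathbb P)$ for some $\delta>0$ and that $\mu=\varphi\cdot\lambda_d$, where the density $\varphi\ge 0$ is radial and non-increasing outside a ball, that is: there are a norm $|\cdot|_0$ on $\mathbb R^d$, a radius $R>0$ and a non-increasing function $h:(R,+\infty)\to[0,+\infty)$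 with $\varphi(\xi)=h(|\xi|_0)$ whenever $|\xi|_0>R$. Suppose further that for some real $c>1$ $$\int_{\mathbb R^d}\varphi(c\,\xi)^{-\frac{q}{p+d}}\,\mu(d\xi)=\int_{\mathbb R^d}\varphi(c\,\xi)^{-\frac{q}{p+d}}\varphi(\xi)\,d\xi<+\infty ,$$ with the conventions $0^{-s}=+\infty$ for $s>0$ and $(+\infty)\cdot 0=0$. Then every $L^p$-optimal greedy sequence for $X$ is $L^q$-rate optimal. (b) Call $\mu$ hyper-exponential with centre $m\in\mathbb R^d$ if it has a density of the form $\xi\mapsto\kappa|\xi-m|_0^{c}\,e^{-a|\xi-m|_0^{b}}$ for some norm $|\cdot|_0$ and constants $\kappa,a,b>0$, $c>-d$; call it Laplace with centre $m$ if it has a density of the form $\xi\mapsto\kappa e^{-a|\xi-m|_0}$ for some norm $|\cdot|_0$ and constants $\kappa,a>0$; by a normal law with centre $m$ we mean one with mean $m$ and positive definite covariance. If $\mu$ is a hyper-exponential, Laplace or normal law with centre $0$, then for every $q\in(0,p+d)$ the hypotheses of (a) hold (for a suitable version $\varphi$ of the density and suitable $\delta>0$, $c>1$). If $\mu$ is a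 hyper-exponential, Laplace or normal law with an arbitrary centre, then for every $q\in(0,p+d)$ every $L^p$-optimal greedy sequence for $X$ is $L^q$-rate optimal. -/

import Mathlib

open MeasureTheory ProbabilityTheory Filter
open scoped ENNReal

namespace GreedyQuantization

/-- The `L^p`-mean quantization error `e_p(Γ, X) = ‖d(X, Γ)‖_p` of the random vector `X` induced by
the set `Γ`, where `d(ξ, Γ)` is the infimum of `|ξ - a|` over `a ∈ Γ`; it takes values in `[0, ∞]`. -/
noncomputable def quantError {E Ω : Type*} [NormedAddCommGroup E] [MeasurableSpace Ω]
    (P : Measure Ω) (X : Ω → E) (p : ℝ) (Γ : Set E) : ℝ≥0∞ :=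
  (∫⁻ ω, (Metric.infEDist (X ω) Γ) ^ p ∂P) ^ (1 / p)

/-- The grid formed by the first `N` terms of a sequence. The terms are numbered from `0`, so that
`a 0, …, a (N - 1)` are the points usually written `a_1, …, a_N`. -/
def grid {E : Type*} (a : ℕ → E) (N : ℕ) : Set E := a '' Set.Iio N

/-- `a` is an `L^p`-optimal greedy quantization sequence of `X`: for every `N ≥ 0` the next point
minimizes `ξ ↦ e_p(a^{(N)} ∪ {ξ}, X)` over the whole space. -/
def IsGreedySequence {E Ω : Type*} [NormedAddCommGroup E] [MeasurableSpace Ω]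
    (P : Measure Ω) (X : Ω → E) (p : ℝ) (a : ℕ → E) : Prop :=
  ∀ N : ℕ, IsMinOn (fun ξ : E => quantError P X p (grid a N ∪ {ξ})) Set.univ (a N)

/-- `a` is `L^q`-rate optimal for `X`: `limsup_N N^{1/d} e_q(a^{(N)}, X) < ∞`, with `d` the
dimension of the space. -/
def IsRateOptimal {E Ω : Type*} [NormedAddCommGroup E] [NormedSpace ℝ E] [MeasurableSpace Ω]
    (P : Measure Ω) (X : Ω → E) (q : ℝ) (a : ℕ → E) : Prop :=
  limsup (fun N : ℕ => (N : ℝ≥0∞) ^ (1 / (Module.finrank ℝ E : ℝ)) * quantError P X q (grid a N))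
    atTop < ∞

/-- `φ` is a nonnegative Borel density of `ν` with respect to `vol`. -/
def IsDensity {E : Type*} [MeasurableSpace E] (vol ν : Measure E) (φ : E → ℝ) : Prop :=
  Measurable φ ∧ (∀ ξ, 0 ≤ φ ξ) ∧ ν = vol.withDensity (fun ξ => ENNReal.ofReal (φ ξ))

/-- A seminorm that is a norm. -/
def IsNorm {E : Type*} [AddCommGroup E] [Module ℝ E] (n₀ : Seminorm ℝ E) : Prop :=
  ∀ x : E, n₀ x = 0 → x = 0

/-- `φ` is radial and non-increasing outside a ball, with respect to some norm `|·|₀` on the space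
(not necessarily the ambient one): `φ = h(|·|₀)` on `{|ξ|₀ > R}` for a non-increasing
`h : (R, ∞) → [0, ∞)`. -/
def IsEssentiallyRadial {E : Type*} [AddCommGroup E] [Module ℝ E] (φ : E → ℝ) : Prop :=
  ∃ (n₀ : Seminorm ℝ E) (R : ℝ) (h : ℝ → ℝ), IsNorm n₀ ∧ 0 < R ∧
    AntitoneOn h (Set.Ioi R) ∧ (∀ r ∈ Set.Ioi R, 0 ≤ h r) ∧
    ∀ ξ : E, R < n₀ ξ → φ ξ = h (n₀ ξ)

/-- `∫ φ(cξ)^{-s} ν(dξ) < ∞` for some real `c > 1`. The negative power is taken in `[0, ∞]`, so that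
it equals `∞` where `φ(cξ) = 0`. -/
def HasDilatedMoment {E : Type*} [AddCommGroup E] [Module ℝ E] [MeasurableSpace E]
    (ν : Measure E) (φ : E → ℝ) (s : ℝ) : Prop :=
  ∃ c : ℝ, 1 < c ∧ ∫⁻ ξ, (ENNReal.ofReal (φ (c • ξ))) ^ (-s) ∂ν < ∞

/-- The density `ξ ↦ κ |ξ - m|₀^c exp(-a |ξ - m|₀^b)`. -/
noncomputable def hyperExpDensity {E : Type*} [AddCommGroup E] [Module ℝ E]
    (n₀ : Seminorm ℝ E) (m : E) (κ a b c : ℝ) (ξ : E) : ℝ :=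
  κ * (n₀ (ξ - m)) ^ c * Real.exp (-a * (n₀ (ξ - m)) ^ b)

/-- `ν` is a hyper-exponential law with centre `m`. -/
def IsHyperExponentialLaw {E : Type*} [AddCommGroup E] [Module ℝ E] [MeasurableSpace E]
    (vol ν : Measure E) (m : E) : Prop :=
  ∃ (n₀ : Seminorm ℝ E) (κ a b c : ℝ), IsNorm n₀ ∧ 0 < κ ∧ 0 < a ∧ 0 < b ∧
    -(Module.finrank ℝ E : ℝ) < c ∧ IsDensity vol ν (hyperExpDensity n₀ m κ a b c)

/-- `ν` is a Laplace law with centre `m`: it has the density `ξ ↦ κ exp(-a |ξ - m|₀)`. -/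
def IsLaplaceLaw {E : Type*} [AddCommGroup E] [Module ℝ E] [MeasurableSpace E]
    (vol ν : Measure E) (m : E) : Prop :=
  ∃ (n₀ : Seminorm ℝ E) (κ a : ℝ), IsNorm n₀ ∧ 0 < κ ∧ 0 < a ∧
    IsDensity vol ν (fun ξ => κ * Real.exp (-a * n₀ (ξ - m)))

/-- `ν` is a non-degenerate normal law with mean `m`. For a Gaussian measure, being absolutely
continuous is the same as having a positive definite covariance. -/
def IsNormalLaw {E : Type*} [NormedAddCommGroup E] [NormedSpace ℝ E] [MeasurableSpace E]
    (vol ν : Measure E) (m : E) : Prop :=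
  IsGaussian ν ∧ ν ≪ vol ∧ ∫ ξ, ξ ∂ν = m

/-- `ν` is a hyper-exponential, Laplace or non-degenerate normal law with centre `m`. -/
def IsExampleLaw {E : Type*} [NormedAddCommGroup E] [NormedSpace ℝ E] [MeasurableSpace E]
    (vol ν : Measure E) (m : E) : Prop :=
  IsHyperExponentialLaw vol ν m ∨ IsLaplaceLaw vol ν m ∨ IsNormalLaw vol ν m

end GreedyQuantization

namespace GreedyQuantization

/-! Write d(x) for the distance of x to the current grid, u_n and w_n for the distortions of order p
and q, and Δ_n = u_n - u_{n+1}. A greedy step does at least as well as adding any point ξ, and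
adding ξ at least halves d(x) wherever |x - ξ| ≤ d(x)/2. So Δ_n dominates (1 - 2^(-p)) times the
integral of d^p over those x, for every ξ. This is used in two ways.

Averaging over ξ against a finite measure with density (1 + ‖ξ‖)^(-η), η > d, bounds a weighted
(p+d)-th moment of d(x) by a multiple of Δ_n (`exists_lintegral_rpow_mul_weight_le`). Hölder's
inequality then gives u_n ≤ K Δ_n^(p/(p+d)) from the moment of order p + δ, and the analogous bound
of order q on bounded sets (`exists_setLIntegral_rpow_le`).

In the tail, ξ itself is tried as the new point: radial monotonicity gives φ ≥ φ(cξ) on a ball of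
radius ε d(ξ), hence d(ξ)^(p+d) φ(cξ) ≤ K Δ_n. Taking the power q/(p+d) and integrating uses exactly
the dilated moment (`exists_setLIntegral_tail_le`). Together, w_n ≤ K Δ_n^(q/(p+d)). The bound q < p
+ d needed for Hölder follows from the hypotheses (`HasDilatedMoment.lt_one`).

The first inequality is a recursion that forces u_n = O(n^(-p/d)). Summing the second over n, …,
2n-1 bounds n w_{2n}^((p+d)/q) by a multiple of u_n, whence w_n = O(n^(-q/d))
(`limsup_rpow_mul_distortion_lt_top`).

For the examples, Laplace and normal laws are hyper-exponential with c = 0 and b = 1 or 2; the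
normal case goes through whitening coordinates. For a centred hyper-exponential law the dilated
integrand is again of the same type, and other centres are handled by translation. -/

/-- The `p`-th power of the `L^p`-mean quantization error, for a law `μ` on the space. -/
noncomputable def distortion {E : Type*} [NormedAddCommGroup E] [MeasurableSpace E]
    (μ : Measure E) (p : ℝ) (Γ : Set E) : ℝ≥0∞ :=
  ∫⁻ x, (Metric.infEDist x Γ) ^ p ∂μ

/-! ### Grids of a sequence. -/

section Grid

variable {E : Type*}

lemma grid_succ (a : ℕ → E) (N : ℕ) : grid a (N + 1) = grid a N ∪ {a N} := by
  ext x
  simp only [grid, Set.mem_image, Set.mem_Iio, Set.mem_union, Set.mem_singleton_iff]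
  constructor
  · rintro ⟨k, hk, rfl⟩
    rcases Nat.lt_succ_iff_lt_or_eq.mp hk with h | rfl
    · exact Or.inl ⟨k, h, rfl⟩
    · exact Or.inr rfl
  · rintro (⟨k, hk, rfl⟩ | rfl)
    · exact ⟨k, by omega, rfl⟩
    · exact ⟨N, by omega, rfl⟩

lemma zero_mem_grid (a : ℕ → E) {N : ℕ} (hN : 1 ≤ N) : a 0 ∈ grid a N :=
  ⟨0, Set.mem_Iio.mpr hN, rfl⟩

lemma grid_mono (a : ℕ → E) : Monotone (grid a) := fun _ _ h =>
  Set.image_mono (Set.Iio_subset_Iio h)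

end Grid

/-! ### The gain in distortion from one added point. -/

section Distortion

lemma distortion_anti {E : Type*} [NormedAddCommGroup E] [MeasurableSpace E] (μ : Measure E) {p : ℝ}
    (hp : 0 ≤ p) {Γ Γ' : Set E} (h : Γ ⊆ Γ') :
    distortion μ p Γ' ≤ distortion μ p Γ :=
  lintegral_mono fun _ => ENNReal.rpow_le_rpow (Metric.infEDist_anti h) hp

lemma infEDist_eq_ofReal {E : Type*} [NormedAddCommGroup E] {Γ : Set E} (h : Γ.Nonempty) (x : E) :
    Metric.infEDist x Γ = ENNReal.ofReal (Metric.infDist x Γ) := by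
  rw [Metric.infDist, ENNReal.ofReal_toReal (Metric.infEDist_ne_top h)]

lemma infDist_le_norm_add {E : Type*} [NormedAddCommGroup E] {Γ : Set E} {a₀ : E} (h : a₀ ∈ Γ) (x : E) :
    Metric.infDist x Γ ≤ ‖x‖ + ‖a₀‖ :=
  (Metric.infDist_le_dist_of_mem h).trans (by rw [dist_eq_norm]; exact norm_sub_le _ _)

variable {E : Type*} [NormedAddCommGroup E] [MeasurableSpace E] [BorelSpace E]

lemma quantError_eq_distortion {Ω : Type*} [MeasurableSpace Ω] (P : Measure Ω) {X : Ω → E}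
    (hX : Measurable X) (p : ℝ) (Γ : Set E) :
    quantError P X p Γ = distortion (P.map X) p Γ ^ (1 / p) := by
  rw [quantError, distortion, lintegral_map _ hX]
  exact measurable_infEDist.pow_const p

/-- The rate estimates use greediness only in this form, free of the outer power 1/p. -/
lemma IsGreedySequence.distortion_le {Ω : Type*} [MeasurableSpace Ω] {P : Measure Ω} {X : Ω → E}
    (hX : Measurable X) {p : ℝ} (hp : 0 < p) {a : ℕ → E} (ha : IsGreedySequence P X p a)
    (N : ℕ) (ξ : E) :
    distortion (P.map X) p (grid a (N + 1)) ≤ distortion (P.map X) p (grid a N ∪ {ξ}) := by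
  have h := ha N (Set.mem_univ ξ)
  simp only [Set.mem_ofPred_eq, quantError_eq_distortion P hX] at h
  rw [grid_succ]
  exact (ENNReal.rpow_le_rpow_iff (by positivity)).mp h

/-- Adding `ξ` to `Γ` lowers the distortion at least by what the points `x` with
`|x - ξ| ≤ d(x, Γ) / 2` gain. -/
lemma distortion_union_singleton_add_le (μ : Measure E) {p : ℝ} (hp : 0 < p) (Γ : Set E) (ξ : E) :
    distortion μ p (Γ ∪ {ξ}) + ENNReal.ofReal (1 - (1 / 2) ^ p) *
      ∫⁻ x, {x | edist x ξ ≤ Metric.infEDist x Γ / 2}.indicator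
        (fun x => Metric.infEDist x Γ ^ p) x ∂μ ≤ distortion μ p Γ := by
  have hs : MeasurableSet {x : E | edist x ξ ≤ Metric.infEDist x Γ / 2} :=
    measurableSet_le measurable_edist_left (measurable_infEDist.div_const 2)
  have hm : Measurable fun x : E => Metric.infEDist x Γ ^ p := measurable_infEDist.pow_const p
  rw [distortion, distortion, ← lintegral_const_mul _ (hm.indicator hs),
    ← lintegral_add_right _ ((hm.indicator hs).const_mul _)]
  refine lintegral_mono fun x => ?_
  by_cases hx : edist x ξ ≤ Metric.infEDist x Γ / 2
  · have h1 : Metric.infEDist x (Γ ∪ {ξ}) ≤ Metric.infEDist x Γ / 2 := by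
      rw [Metric.infEDist_union, Metric.infEDist_singleton]
      exact inf_le_right.trans hx
    have h2 : (1 / 2 : ℝ) ^ p ≤ 1 := Real.rpow_le_one (by norm_num) (by norm_num) hp.le
    rw [Set.indicator_of_mem (by exact hx)]
    calc Metric.infEDist x (Γ ∪ {ξ}) ^ p + ENNReal.ofReal (1 - (1 / 2) ^ p) * Metric.infEDist x Γ ^ p
        ≤ (Metric.infEDist x Γ / 2) ^ p
          + ENNReal.ofReal (1 - (1 / 2) ^ p) * Metric.infEDist x Γ ^ p := by gcongr
      _ = (ENNReal.ofReal ((1 / 2) ^ p) + ENNReal.ofReal (1 - (1 / 2) ^ p))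
          * Metric.infEDist x Γ ^ p := by
        rw [add_mul, ENNReal.div_eq_inv_mul, ENNReal.mul_rpow_of_nonneg _ _ hp.le,
          ← ENNReal.ofReal_rpow_of_nonneg (by norm_num) hp.le]
        congr 3
        rw [one_div, ENNReal.ofReal_inv_of_pos two_pos]
        simp
      _ = Metric.infEDist x Γ ^ p := by
        rw [← ENNReal.ofReal_add (by positivity) (by linarith)]
        simp
  · rw [Set.indicator_of_notMem (by exact hx)]
    simp only [mul_zero, add_zero]
    exact ENNReal.rpow_le_rpow (Metric.infEDist_anti Set.subset_union_left) hp.le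

lemma ofReal_one_sub_half_rpow_pos {p : ℝ} (hp : 0 < p) :
    ENNReal.ofReal (1 - (1 / 2) ^ p) ≠ 0 := by
  have : (1 / 2 : ℝ) ^ p < 1 := Real.rpow_lt_one (by norm_num) (by norm_num) hp
  simpa using this

/-- The inequality `distortion_union_singleton_add_le` averaged with respect to a measure `ν`. -/
lemma lintegral_rpow_mul_measure_le [SecondCountableTopology E] (μ ν : Measure E) [SFinite μ]
    [IsFiniteMeasure ν] {p : ℝ} (hp : 0 < p) {Γ Γ' : Set E} (hΓ : distortion μ p Γ ≠ ∞)
    (h : ∀ ξ, distortion μ p Γ' ≤ distortion μ p (Γ ∪ {ξ})) (h' : Γ ⊆ Γ') :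
    ENNReal.ofReal (1 - (1 / 2) ^ p) *
      ∫⁻ x, Metric.infEDist x Γ ^ p * ν {ξ | edist x ξ ≤ Metric.infEDist x Γ / 2} ∂μ ≤
      (distortion μ p Γ - distortion μ p Γ') * ν Set.univ := by
  have hΓ' : distortion μ p Γ' ≠ ∞ := ((distortion_anti μ hp.le h').trans_lt hΓ.lt_top).ne
  set C := ENNReal.ofReal (1 - (1 / 2) ^ p)
  -- The pairs (x, ξ) for which ξ halves the distance of x to the grid. By Tonelli, integrating in ξ
  -- first turns the indicator into the `ν`-measure of a ball around x.
  let S : Set (E × E) := {z | edist z.1 z.2 ≤ Metric.infEDist z.1 Γ / 2}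
  have hS : MeasurableSet S :=
    measurableSet_le measurable_edist ((measurable_infEDist.comp measurable_fst).div_const 2)
  have hm : Measurable (S.indicator fun z : E × E => Metric.infEDist z.1 Γ ^ p) :=
    ((measurable_infEDist.comp measurable_fst).pow_const p).indicator hS
  have key : ∀ ξ, C * ∫⁻ x, S.indicator (fun z => Metric.infEDist z.1 Γ ^ p) (x, ξ) ∂μ ≤
      distortion μ p Γ - distortion μ p Γ' := by
    intro ξ
    refine ENNReal.le_sub_of_add_le_right hΓ' ?_
    rw [add_comm]
    refine le_trans ?_ (distortion_union_singleton_add_le μ hp Γ ξ)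
    gcongr
    · exact h ξ
    · exact le_of_eq rfl
  calc C * ∫⁻ x, Metric.infEDist x Γ ^ p * ν {ξ | edist x ξ ≤ Metric.infEDist x Γ / 2} ∂μ
      = C * ∫⁻ x, ∫⁻ ξ, S.indicator (fun z => Metric.infEDist z.1 Γ ^ p) (x, ξ) ∂ν ∂μ := by
        congr 1
        refine lintegral_congr fun x => ?_
        have hx : MeasurableSet {ξ : E | edist x ξ ≤ Metric.infEDist x Γ / 2} :=
          measurableSet_le measurable_edist_right measurable_const
        rw [← setLIntegral_const, ← lintegral_indicator hx]
        exact lintegral_congr fun ξ => rfl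
    _ = ∫⁻ ξ, C * ∫⁻ x, S.indicator (fun z => Metric.infEDist z.1 Γ ^ p) (x, ξ) ∂μ ∂ν := by
        rw [lintegral_lintegral_swap
          (f := fun x ξ => S.indicator (fun z => Metric.infEDist z.1 Γ ^ p) (x, ξ)) hm.aemeasurable,
          lintegral_const_mul _ hm.lintegral_prod_left']
    _ ≤ ∫⁻ _, (distortion μ p Γ - distortion μ p Γ') ∂ν := lintegral_mono key
    _ = (distortion μ p Γ - distortion μ p Γ') * ν Set.univ := lintegral_const _

end Distortion

/-! ### Averaging the gain over the new point, and Hölder's inequality. -/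

section Weighted

variable {E : Type*} [NormedAddCommGroup E] [NormedSpace ℝ E] [FiniteDimensional ℝ E]
  [MeasurableSpace E] [BorelSpace E]

/-- One greedy step lowers the distortion at least by a multiple of a weighted `(p + d)`-th moment
of the distance to the grid. -/
lemma exists_lintegral_rpow_mul_weight_le (vol : Measure E) [vol.IsAddHaarMeasure]
    {p η : ℝ} (hp : 0 < p) (hη : (Module.finrank ℝ E : ℝ) < η) (a₀ : E) :
    ∃ K : ℝ≥0∞, K ≠ ∞ ∧ ∀ (μ : Measure E) [SFinite μ] (Γ Γ' : Set E), a₀ ∈ Γ → Γ ⊆ Γ' →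
      distortion μ p Γ ≠ ∞ → (∀ ξ, distortion μ p Γ' ≤ distortion μ p (Γ ∪ {ξ})) →
      ∫⁻ x, Metric.infEDist x Γ ^ (p + Module.finrank ℝ E) * ENNReal.ofReal ((1 + ‖x‖) ^ (-η)) ∂μ
        ≤ K * (distortion μ p Γ - distortion μ p Γ') := by
  set d := Module.finrank ℝ E
  have hη0 : 0 < η := lt_of_le_of_lt (Nat.cast_nonneg _) hη
  let w : E → ℝ≥0∞ := fun ξ => ENNReal.ofReal ((1 + ‖ξ‖) ^ (-η))
  have hw : Measurable w := by fun_prop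
  let ν : Measure E := vol.withDensity w
  have hν : IsFiniteMeasure ν := by
    refine isFiniteMeasure_withDensity ?_
    exact (finite_integral_one_add_norm (μ := vol) hη).ne
  set V := vol (Metric.ball 0 1)
  have hV : V ≠ 0 := (Metric.measure_ball_pos vol 0 one_pos).ne'
  have hV' : V ≠ ∞ := measure_ball_lt_top.ne
  set C := ENNReal.ofReal (1 - (1 / 2) ^ p)
  let κ : ℝ≥0∞ := ENNReal.ofReal ((2 + ‖a₀‖) ^ (-η) * (1 / 2) ^ d) * V
  have hκ : κ ≠ 0 := mul_ne_zero (by simp only [ne_eq, ENNReal.ofReal_eq_zero, not_le]; positivity) hV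
  have hκ' : κ ≠ ∞ := ENNReal.mul_ne_top ENNReal.ofReal_ne_top hV'
  have hCκ : C * κ ≠ 0 := mul_ne_zero (ofReal_one_sub_half_rpow_pos hp) hκ
  have hCκ' : C * κ ≠ ∞ := ENNReal.mul_ne_top ENNReal.ofReal_ne_top hκ'
  refine ⟨(C * κ)⁻¹ * ν Set.univ, ENNReal.mul_ne_top (ENNReal.inv_ne_top.mpr hCκ)
    (measure_ne_top _ _), ?_⟩
  intro μ _ Γ Γ' ha₀ hsub hfin hmin
  have main := lintegral_rpow_mul_measure_le μ ν hp hfin hmin hsub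
  have hlow : ∀ x, κ * (Metric.infEDist x Γ ^ (p + d) * w x) ≤
      Metric.infEDist x Γ ^ p * ν {ξ | edist x ξ ≤ Metric.infEDist x Γ / 2} := by
    intro x
    set r := Metric.infDist x Γ
    have hr : 0 ≤ r := Metric.infDist_nonneg
    have hrle : r ≤ ‖x‖ + ‖a₀‖ := infDist_le_norm_add ha₀ x
    have hset : {ξ | edist x ξ ≤ Metric.infEDist x Γ / 2} = Metric.closedBall x (r / 2) := by
      ext ξ
      rw [Set.mem_ofPred_eq, infEDist_eq_ofReal ⟨a₀, ha₀⟩, Metric.mem_closedBall, dist_comm,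
        edist_dist, show (2 : ℝ≥0∞) = ENNReal.ofReal 2 by simp, ← ENNReal.ofReal_div_of_pos two_pos,
        ENNReal.ofReal_le_ofReal_iff (by positivity)]
    -- On this ball 1 + ‖ξ‖ ≤ (2 + ‖a₀‖)(1 + ‖x‖), because the distance of x to `Γ` is at most ‖x‖ +
    -- ‖a₀‖. The fixed grid point `a₀` makes the constant independent of `Γ`.
    have hball : ENNReal.ofReal ((2 + ‖a₀‖) ^ (-η) * (1 + ‖x‖) ^ (-η)) *
        (ENNReal.ofReal ((r / 2) ^ d) * V) ≤ ν (Metric.closedBall x (r / 2)) := by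
      rw [withDensity_apply _ Metric.isClosed_closedBall.measurableSet,
        ← Measure.addHaar_closedBall vol x (by positivity), ← setLIntegral_const]
      refine setLIntegral_mono hw fun ξ hξ => ENNReal.ofReal_le_ofReal ?_
      rw [← Real.mul_rpow (by positivity) (by positivity)]
      refine Real.rpow_le_rpow_of_nonpos (by positivity) ?_ (by linarith)
      have h1 : ‖ξ‖ ≤ ‖x‖ + r / 2 := by
        have := norm_le_norm_add_norm_sub x ξ
        rw [Metric.mem_closedBall, dist_eq_norm, norm_sub_rev] at hξ
        linarith
      nlinarith [norm_nonneg x, norm_nonneg a₀, mul_nonneg (norm_nonneg x) (norm_nonneg a₀)]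
    rw [hset]
    refine le_trans (le_of_eq ?_) (mul_le_mul_right hball _)
    rw [infEDist_eq_ofReal ⟨a₀, ha₀⟩]
    simp only [κ, w]
    rw [ENNReal.rpow_add_of_nonneg _ _ hp.le (Nat.cast_nonneg _), ENNReal.rpow_natCast,
      ENNReal.ofReal_mul (by positivity), ENNReal.ofReal_mul (by positivity),
      show (r / 2) ^ d = r ^ d * (1 / 2) ^ d by rw [← mul_pow]; congr 1; ring,
      ENNReal.ofReal_mul (by positivity), ENNReal.ofReal_pow hr]
    ring
  have hmeas : Measurable fun x : E => Metric.infEDist x Γ ^ (p + d) * w x :=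
    (measurable_infEDist.pow_const _).mul hw
  have : (C * κ) * ∫⁻ x, Metric.infEDist x Γ ^ (p + d) * w x ∂μ ≤
      (distortion μ p Γ - distortion μ p Γ') * ν Set.univ := by
    refine le_trans ?_ main
    rw [mul_assoc, ← lintegral_const_mul _ hmeas]
    exact mul_le_mul_right (lintegral_mono hlow) _
  rw [mul_assoc, mul_comm (ν Set.univ), ← ENNReal.div_eq_inv_mul,
    ENNReal.le_div_iff_mul_le (Or.inl hCκ) (Or.inl hCκ'), mul_comm]
  exact this

/-- Hölder's inequality turns the weighted bound into a bound for the distortion of order `r` on a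
set where a suitable moment is finite. -/
lemma exists_setLIntegral_rpow_le (vol : Measure E) [vol.IsAddHaarMeasure]
    {p η r : ℝ} (hp : 0 < p) (hη : (Module.finrank ℝ E : ℝ) < η) (hr : 0 < r)
    (hr' : r < p + Module.finrank ℝ E) (a₀ : E) (μ : Measure E) [SFinite μ] (S : Set E)
    (hS : ∫⁻ x in S, ENNReal.ofReal ((1 + ‖x‖) ^ (η * (r / (p + Module.finrank ℝ E - r)))) ∂μ ≠ ∞) :
    ∃ K : ℝ≥0∞, K ≠ ∞ ∧ ∀ Γ Γ' : Set E, a₀ ∈ Γ → Γ ⊆ Γ' →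
      distortion μ p Γ ≠ ∞ → (∀ ξ, distortion μ p Γ' ≤ distortion μ p (Γ ∪ {ξ})) →
      ∫⁻ x in S, Metric.infEDist x Γ ^ r ∂μ
        ≤ K * (distortion μ p Γ - distortion μ p Γ') ^ (r / (p + Module.finrank ℝ E)) := by
  obtain ⟨K, hK, hKb⟩ := exists_lintegral_rpow_mul_weight_le vol hp hη a₀
  set d := Module.finrank ℝ E
  have hpd : 0 < p + d := by positivity
  set t := r / (p + d)
  have ht : 0 < t := by positivity
  have ht1 : 0 < 1 - t := by
    have : t < 1 := (div_lt_one hpd).mpr hr'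
    linarith
  set I := ∫⁻ x in S, ENNReal.ofReal ((1 + ‖x‖) ^ (η * (r / (p + d - r)))) ∂μ
  refine ⟨K ^ t * I ^ (1 - t), ENNReal.mul_ne_top (ENNReal.rpow_ne_top_of_nonneg ht.le hK)
    (ENNReal.rpow_ne_top_of_nonneg ht1.le hS), ?_⟩
  intro Γ Γ' ha₀ hsub hfin hmin
  have hb := hKb μ Γ Γ' ha₀ hsub hfin hmin
  have hm1 : Measurable fun x : E => Metric.infEDist x Γ ^ (p + d) *
      ENNReal.ofReal ((1 + ‖x‖) ^ (-η)) := (measurable_infEDist.pow_const _).mul (by fun_prop)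
  have hm2 : Measurable fun x : E => ENNReal.ofReal ((1 + ‖x‖) ^ (η * (r / (p + d - r)))) := by
    fun_prop
  -- Hölder splitting with exponents 1/t and 1/(1-t); the power of 1 + ‖x‖ in the second factor is
  -- the one that cancels the weight of the first.
  have hpt : ∀ x : E, Metric.infEDist x Γ ^ r =
      (Metric.infEDist x Γ ^ (p + d) * ENNReal.ofReal ((1 + ‖x‖) ^ (-η))) ^ t *
        ENNReal.ofReal ((1 + ‖x‖) ^ (η * (r / (p + d - r)))) ^ (1 - t) := by
    intro x
    have h1 : (p + d) * t = r := by simp only [t]; field_simp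
    have h0 : 0 < 1 + ‖x‖ := by positivity
    have h2 : η * (r / (p + d - r)) * (1 - t) = η * t := by
      have : p + d - r ≠ 0 := by linarith
      simp only [t]
      field_simp
    rw [ENNReal.mul_rpow_of_nonneg _ _ ht.le, ← ENNReal.rpow_mul, h1,
      ENNReal.ofReal_rpow_of_pos (by positivity), ENNReal.ofReal_rpow_of_pos (by positivity),
      ← Real.rpow_mul h0.le, ← Real.rpow_mul h0.le, h2, mul_assoc,
      ← ENNReal.ofReal_mul (by positivity), ← Real.rpow_add h0]
    simp
  calc ∫⁻ x in S, Metric.infEDist x Γ ^ r ∂μ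
      = ∫⁻ x in S, (Metric.infEDist x Γ ^ (p + d) * ENNReal.ofReal ((1 + ‖x‖) ^ (-η))) ^ t *
        ENNReal.ofReal ((1 + ‖x‖) ^ (η * (r / (p + d - r)))) ^ (1 - t) ∂μ :=
        lintegral_congr fun x => hpt x
    _ ≤ (∫⁻ x in S, Metric.infEDist x Γ ^ (p + d) * ENNReal.ofReal ((1 + ‖x‖) ^ (-η)) ∂μ) ^ t *
        I ^ (1 - t) :=
        ENNReal.lintegral_mul_norm_pow_le hm1.aemeasurable hm2.aemeasurable ht.le ht1.le (by ring)
    _ ≤ (K * (distortion μ p Γ - distortion μ p Γ')) ^ t * I ^ (1 - t) := by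
        gcongr
        exact (setLIntegral_le_lintegral _ _).trans hb
    _ = K ^ t * I ^ (1 - t) * (distortion μ p Γ - distortion μ p Γ') ^ t := by
        rw [ENNReal.mul_rpow_of_nonneg _ _ ht.le]
        ring

end Weighted

/-! ### Real sequences: from one-step inequalities to decay rates. -/

section Recursion

/-- For positive terms the recursion says 1/y_{n+1} ≥ 1 + 1/y_n. No bound on y_1 is needed, since
t/(1+t) ≤ 1. -/
lemma le_one_div_of_le_div_one_add {y : ℕ → ℝ} (hy : ∀ n, 0 ≤ y n)
    (h : ∀ n, 1 ≤ n → y (n + 1) ≤ y n / (1 + y n)) : ∀ n : ℕ, 1 ≤ n → y (n + 1) ≤ 1 / n := by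
  intro n hn
  induction n, hn using Nat.le_induction with
  | base =>
    refine (h 1 le_rfl).trans ?_
    rw [Nat.cast_one, div_one, div_le_one (by linarith [hy 1])]
    linarith
  | succ n hn ih =>
    have hn0 : (0 : ℝ) < n := by exact_mod_cast hn
    refine (h (n + 1) (by omega)).trans ?_
    have hpos := hy (n + 1)
    rw [le_div_iff₀ hn0] at ih
    rw [div_le_div_iff₀ (by linarith) (by positivity)]
    push_cast
    linarith

/-- A nonnegative sequence with `κ v_n ^ (1 + d/p) ≤ v_n - v_{n+1}` is `O(n ^ (-p/d))`. -/
lemma exists_le_mul_rpow_of_rpow_le_sub {v : ℕ → ℝ} (hv : ∀ n, 0 ≤ v n) {p d κ : ℝ} (hp : 0 < p)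
    (hd : 0 < d) (hκ : 0 < κ)
    (h : ∀ n, 1 ≤ n → κ * v n ^ (1 + d / p) ≤ v n - v (n + 1)) :
    ∃ C, 0 ≤ C ∧ ∀ n : ℕ, 2 ≤ n → v n ≤ C * (n : ℝ) ^ (-(p / d)) := by
  set α := d / p
  have hα : 0 < α := by positivity
  -- The hypothesis gives v_{n+1} ≤ v_n (1 - κ v_n^α) ≤ v_n exp(-κ v_n^α). Its α-th power, with this
  -- normalisation, reads y_{n+1} ≤ y_n exp(-y_n) ≤ y_n / (1 + y_n).
  let y : ℕ → ℝ := fun n => α * κ * v n ^ α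
  have hy : ∀ n, 0 ≤ y n := fun n => by have := hv n; positivity
  have hrec : ∀ n, 1 ≤ n → y (n + 1) ≤ y n / (1 + y n) := by
    intro n hn
    have h1 : v (n + 1) ≤ v n * Real.exp (-(κ * v n ^ α)) := by
      have h2 := h n hn
      rw [Real.rpow_add_of_nonneg (hv n) zero_le_one hα.le, Real.rpow_one] at h2
      have h3 := Real.add_one_le_exp (-(κ * v n ^ α))
      nlinarith [mul_le_mul_of_nonneg_left h3 (hv n)]
    have h4 : v (n + 1) ^ α ≤ v n ^ α * Real.exp (-y n) := by
      refine (Real.rpow_le_rpow (hv _) h1 hα.le).trans (le_of_eq ?_)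
      rw [Real.mul_rpow (hv n) (Real.exp_pos _).le, ← Real.exp_mul]
      congr 2
      simp only [y]
      ring
    have h5 : Real.exp (-y n) ≤ 1 / (1 + y n) := by
      rw [Real.exp_neg, one_div]
      refine inv_anti₀ (by linarith [hy n]) ?_
      linarith [Real.add_one_le_exp (y n)]
    calc y (n + 1) ≤ α * κ * (v n ^ α * Real.exp (-y n)) := by
          simp only [y]; gcongr
      _ = y n * Real.exp (-y n) := by simp only [y]; ring
      _ ≤ y n * (1 / (1 + y n)) := mul_le_mul_of_nonneg_left h5 (hy n)
      _ = y n / (1 + y n) := by ring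
  have hb := le_one_div_of_le_div_one_add hy hrec
  -- The factor 2 comes from 1/m ≤ 2/(m+1).
  refine ⟨(2 / (α * κ)) ^ (p / d), by positivity, fun n hn => ?_⟩
  obtain ⟨m, rfl⟩ : ∃ m, n = m + 1 := ⟨n - 1, by omega⟩
  have hm : 1 ≤ m := by omega
  have hm' : (1 : ℝ) ≤ m := by exact_mod_cast hm
  have h1 := hb m hm
  have h2 : v (m + 1) ^ α ≤ 2 / (α * κ) * ((m + 1 : ℕ) : ℝ)⁻¹ := by
    rw [← div_eq_mul_inv, div_div, le_div_iff₀ (by positivity)]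
    simp only [y] at h1
    rw [le_div_iff₀ (by positivity)] at h1
    push_cast
    have : 0 ≤ α * κ * v (m + 1) ^ α := hy (m + 1)
    nlinarith
  have h3 : v (m + 1) = (v (m + 1) ^ α) ^ (p / d) := by
    rw [← Real.rpow_mul (hv _)]
    have : α * (p / d) = 1 := by simp only [α]; field_simp
    rw [this, Real.rpow_one]
  rw [h3, Real.rpow_neg (by positivity), ← Real.inv_rpow (by positivity),
    ← Real.mul_rpow (by positivity) (by positivity)]
  have := hv (m + 1)
  exact Real.rpow_le_rpow (by positivity) h2 (by positivity)

/-- If `κ w_n ^ θ ≤ v_n - v_{n+1}` with `w` non-increasing and `v_n = O(n ^ (-γ))`, then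
`w_n = O(n ^ (-(γ + 1) / θ))`. -/
lemma exists_le_mul_rpow_of_rpow_le_sub_of_antitone {v w : ℕ → ℝ} (hv : ∀ n, 0 ≤ v n)
    (hw : ∀ n, 0 ≤ w n) (hwa : ∀ m n, 1 ≤ m → m ≤ n → w n ≤ w m) {κ θ γ C : ℝ} (hκ : 0 < κ)
    (hθ : 0 < θ) (hγ : 0 ≤ γ) (hC : 0 ≤ C)
    (h : ∀ n, 1 ≤ n → κ * w n ^ θ ≤ v n - v (n + 1))
    (hvb : ∀ n : ℕ, 2 ≤ n → v n ≤ C * (n : ℝ) ^ (-γ)) :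
    ∃ C', 0 ≤ C' ∧ ∀ n : ℕ, 4 ≤ n → w n ≤ C' * (n : ℝ) ^ (-((γ + 1) / θ)) := by
  -- Telescoping from n to 2n: by monotonicity of w each of the n drops of v is at least κ w_{2n}^θ.
  have hsum : ∀ n : ℕ, 1 ≤ n → n * (κ * w (2 * n) ^ θ) ≤ v n := by
    intro n hn
    have h1 : ∀ j ≤ n, j * (κ * w (2 * n) ^ θ) ≤ v n - v (n + j) := by
      intro j
      induction j with
      | zero => simp
      | succ j ih =>
        intro hj
        have h2 := ih (by omega)
        have h3 := h (n + j) (by omega)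
        have h4 : κ * w (2 * n) ^ θ ≤ κ * w (n + j) ^ θ := by
          have := hwa (n + j) (2 * n) (by omega) (by omega)
          have := hw (2 * n)
          gcongr
        push_cast
        rw [← add_assoc]
        linarith
    have := h1 n le_rfl
    linarith [hv (n + n)]
  -- With n = ⌊N/2⌋ one has N ≤ 3n, hence the 3; N ≥ 4 makes n ≥ 2, where the bound on v starts.
  refine ⟨(C / κ * 3 ^ (γ + 1)) ^ (1 / θ), by positivity, fun N hN => ?_⟩
  set n := N / 2
  have hn : 2 ≤ n := by omega
  have hN3 : N ≤ 3 * n := by omega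
  have hn0 : (0 : ℝ) < n := by positivity
  have hN0 : (0 : ℝ) < N := by positivity
  have h1 : w N ≤ w (2 * n) := hwa _ _ (by omega) (by omega)
  have h2 : w N ^ θ ≤ w (2 * n) ^ θ := Real.rpow_le_rpow (hw _) h1 hθ.le
  have h3 := (hsum n (by omega)).trans (hvb n hn)
  have h4 : w N ^ θ ≤ C / κ * 3 ^ (γ + 1) * (N : ℝ) ^ (-(γ + 1)) := by
    have h5 : w (2 * n) ^ θ ≤ C / κ * (n : ℝ) ^ (-(γ + 1)) := by
      rw [neg_add, Real.rpow_add hn0, Real.rpow_neg_one, ← div_eq_mul_inv,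
        mul_div_assoc', le_div_iff₀ hn0, div_mul_eq_mul_div, le_div_iff₀ hκ]
      linarith
    have h6 : (n : ℝ) ^ (-(γ + 1)) ≤ 3 ^ (γ + 1) * (N : ℝ) ^ (-(γ + 1)) := by
      have h7 : (N : ℝ) / 3 ≤ n := by
        rw [div_le_iff₀ (by norm_num)]
        exact_mod_cast (by omega : N ≤ n * 3)
      refine (Real.rpow_le_rpow_of_nonpos (by positivity) h7 (by linarith)).trans (le_of_eq ?_)
      rw [Real.div_rpow hN0.le (by norm_num), Real.rpow_neg (by norm_num : (0 : ℝ) ≤ 3)]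
      field_simp
    calc w N ^ θ ≤ C / κ * (n : ℝ) ^ (-(γ + 1)) := h2.trans h5
      _ ≤ C / κ * (3 ^ (γ + 1) * (N : ℝ) ^ (-(γ + 1))) := by gcongr
      _ = _ := by ring
  have h8 : w N = (w N ^ θ) ^ (1 / θ) := by
    rw [← Real.rpow_mul (hw _), mul_one_div_cancel hθ.ne', Real.rpow_one]
  have h9 : (N : ℝ) ^ (-((γ + 1) / θ)) = ((N : ℝ) ^ (-(γ + 1))) ^ (1 / θ) := by
    rw [← Real.rpow_mul hN0.le]
    congr 1
    ring
  rw [h8, h9, ← Real.mul_rpow (by positivity) (by positivity)]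
  have := hw N
  exact Real.rpow_le_rpow (by positivity) h4 (by positivity)

/-- From `w ≤ K (u - u') ^ β` in `[0, ∞]` to a lower bound of `u - u'` in `ℝ`. -/
lemma exists_mul_toReal_rpow_le_sub {K : ℝ≥0∞} (hK : K ≠ ∞) {β : ℝ} (hβ : 0 < β) :
    ∃ κ : ℝ, 0 < κ ∧ ∀ u u' w : ℝ≥0∞, u ≠ ∞ → u' ≤ u → w ≤ K * (u - u') ^ β →
      κ * w.toReal ^ (1 / β) ≤ u.toReal - u'.toReal := by
  -- Adding 1 keeps the constant positive when `K` is 0.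
  refine ⟨((K.toReal + 1) ^ (1 / β))⁻¹, by positivity, fun u u' w hu huu hw => ?_⟩
  have h1 : w.toReal ≤ (K.toReal + 1) * (u.toReal - u'.toReal) ^ β := by
    have hfin : K * (u - u') ^ β ≠ ∞ :=
      ENNReal.mul_ne_top hK (ENNReal.rpow_ne_top_of_nonneg hβ.le (ENNReal.sub_ne_top hu))
    refine (ENNReal.toReal_mono hfin hw).trans ?_
    rw [ENNReal.toReal_mul, ← ENNReal.toReal_rpow, ENNReal.toReal_sub_of_le huu hu]
    have : 0 ≤ u.toReal - u'.toReal := sub_nonneg.mpr (ENNReal.toReal_mono hu huu)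
    have h2 : 0 ≤ (u.toReal - u'.toReal) ^ β := by positivity
    nlinarith
  have h0 : 0 ≤ u.toReal - u'.toReal := sub_nonneg.mpr (ENNReal.toReal_mono hu huu)
  rw [inv_mul_le_iff₀ (by positivity)]
  have h2 := Real.rpow_le_rpow ENNReal.toReal_nonneg h1 (by positivity : 0 ≤ 1 / β)
  rw [Real.mul_rpow (by positivity) (by positivity), ← Real.rpow_mul h0,
    mul_one_div_cancel hβ.ne', Real.rpow_one] at h2
  exact h2

end Recursion

/-! ### The rate from two one-step inequalities. -/

section Rate

variable {E : Type*} [NormedAddCommGroup E] [MeasurableSpace E]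

/-- The hypothesis `h₁` alone yields the rate n^(-p/d) for the distortion of order p. Fed into `h₂`
summed over a dyadic block, it yields n^(-q/d) for order q. -/
lemma limsup_rpow_mul_distortion_lt_top (μ : Measure E) {p q d : ℝ} (hp : 0 < p) (hq : 0 < q)
    (hd : 0 < d) (a : ℕ → E) (hfin : ∀ n, 1 ≤ n → distortion μ p (grid a n) ≠ ∞)
    {K₁ K₂ : ℝ≥0∞} (hK₁ : K₁ ≠ ∞) (hK₂ : K₂ ≠ ∞)
    (h₁ : ∀ n, 1 ≤ n → distortion μ p (grid a n) ≤
      K₁ * (distortion μ p (grid a n) - distortion μ p (grid a (n + 1))) ^ (p / (p + d)))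
    (h₂ : ∀ n, 1 ≤ n → distortion μ q (grid a n) ≤
      K₂ * (distortion μ p (grid a n) - distortion μ p (grid a (n + 1))) ^ (q / (p + d))) :
    limsup (fun N : ℕ => (N : ℝ≥0∞) ^ (1 / d) * distortion μ q (grid a N) ^ (1 / q)) atTop
      < ∞ := by
  have hpd : 0 < p + d := by positivity
  have hanti : ∀ n, distortion μ p (grid a (n + 1)) ≤ distortion μ p (grid a n) := fun n =>
    distortion_anti μ hp.le (grid_mono a (Nat.le_succ n))
  have hfinq : ∀ n, 1 ≤ n → distortion μ q (grid a n) ≠ ∞ := fun n hn =>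
    ((h₂ n hn).trans_lt (ENNReal.mul_lt_top hK₂.lt_top (ENNReal.rpow_lt_top_of_nonneg
      (by positivity) (ENNReal.sub_ne_top (hfin n hn))))).ne
  obtain ⟨κ₁, hκ₁, H₁⟩ := exists_mul_toReal_rpow_le_sub hK₁ (β := p / (p + d)) (by positivity)
  obtain ⟨κ₂, hκ₂, H₂⟩ := exists_mul_toReal_rpow_le_sub hK₂ (β := q / (p + d)) (by positivity)
  have e₁ : 1 / (p / (p + d)) = 1 + d / p := by field_simp
  obtain ⟨C, hC, hCb⟩ := exists_le_mul_rpow_of_rpow_le_sub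
    (v := fun n => (distortion μ p (grid a n)).toReal) (fun n => ENNReal.toReal_nonneg) hp hd hκ₁
    (fun n hn => by rw [← e₁]; exact H₁ _ _ _ (hfin n hn) (hanti n) (h₁ n hn))
  obtain ⟨C', hC', hCb'⟩ := exists_le_mul_rpow_of_rpow_le_sub_of_antitone
    (v := fun n => (distortion μ p (grid a n)).toReal)
    (w := fun n => (distortion μ q (grid a n)).toReal) (fun n => ENNReal.toReal_nonneg)
    (fun n => ENNReal.toReal_nonneg)
    (fun m n hm hmn => ENNReal.toReal_mono (hfinq m hm) (distortion_anti μ hq.le (grid_mono a hmn)))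
    hκ₂ (θ := 1 / (q / (p + d))) (by positivity) (γ := p / d) (by positivity) hC
    (fun n hn => H₂ _ _ _ (hfin n hn) (hanti n) (h₂ n hn)) hCb
  have e₂ : (p / d + 1) / (1 / (q / (p + d))) = q / d := by field_simp
  rw [e₂] at hCb'
  refine lt_of_le_of_lt (limsup_le_of_le (a := ENNReal.ofReal (C' ^ (1 / q))) (by isBoundedDefault)
    ?_) ENNReal.ofReal_lt_top
  filter_upwards [eventually_ge_atTop 4] with n hn
  have hn0 : (0 : ℝ) < n := by positivity
  rw [← ENNReal.ofReal_toReal (hfinq n (by omega)), ← ENNReal.ofReal_natCast,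
    ENNReal.ofReal_rpow_of_pos hn0, ENNReal.ofReal_rpow_of_nonneg ENNReal.toReal_nonneg
    (by positivity), ← ENNReal.ofReal_mul (by positivity)]
  refine ENNReal.ofReal_le_ofReal ?_
  have h3 := Real.rpow_le_rpow ENNReal.toReal_nonneg (hCb' n hn) (by positivity : 0 ≤ 1 / q)
  rw [Real.mul_rpow hC' (by positivity), ← Real.rpow_mul hn0.le,
    show -(q / d) * (1 / q) = -(1 / d) by field_simp, Real.rpow_neg hn0.le] at h3
  have h4 : 0 < (n : ℝ) ^ (1 / d) := by positivity
  calc _ ≤ (n : ℝ) ^ (1 / d) * (C' ^ (1 / q) * ((n : ℝ) ^ (1 / d))⁻¹) := by gcongr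
    _ = C' ^ (1 / q) := by field_simp

end Rate

/-! ### Comparison of norms in finite dimension. -/

section Norms

variable {E : Type*} [NormedAddCommGroup E] [NormedSpace ℝ E] [FiniteDimensional ℝ E]

/-- A convex function on a finite-dimensional space is continuous. -/
lemma continuous_seminorm (n₀ : Seminorm ℝ E) : Continuous n₀ :=
  continuousOn_univ.mp (n₀.convexOn.continuousOn isOpen_univ)

lemma exists_seminorm_le_mul_norm (n₀ : Seminorm ℝ E) : ∃ c, 0 < c ∧ ∀ x, n₀ x ≤ c * ‖x‖ :=
  n₀.bound_of_continuous_normedSpace (continuous_seminorm n₀)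

lemma IsNorm.exists_mul_norm_le {n₀ : Seminorm ℝ E} (h : IsNorm n₀) :
    ∃ c, 0 < c ∧ ∀ x, c * ‖x‖ ≤ n₀ x := by
  rcases subsingleton_or_nontrivial E with hE | hE
  · exact ⟨1, one_pos, fun x => by simp [Subsingleton.elim x 0]⟩
  obtain ⟨z, hz, hzm⟩ := (isCompact_sphere (0 : E) 1).exists_isMinOn
    (NormedSpace.sphere_nonempty.mpr zero_le_one) (continuous_seminorm n₀).continuousOn
  have hz1 : ‖z‖ = 1 := by simpa using hz
  have hpos : 0 < n₀ z := (apply_nonneg n₀ z).lt_of_ne' fun h0 => by simp [h z h0] at hz1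
  refine ⟨n₀ z, hpos, fun x => ?_⟩
  rcases eq_or_ne x 0 with rfl | hx
  · simp
  have hx' : 0 < ‖x‖ := norm_pos_iff.mpr hx
  have h1 : n₀ z ≤ n₀ (‖x‖⁻¹ • x) := hzm (by simp [norm_smul, hx'.ne'])
  rw [map_smul_eq_mul, norm_inv, norm_norm, ← div_eq_inv_mul, le_div_iff₀ hx'] at h1
  exact h1

end Norms

/-! ### Moments and finiteness of the distortion. -/

section Moments

lemma lintegral_one_add_norm_rpow_ne_top {E : Type*} [NormedAddCommGroup E] [MeasurableSpace E]
    {μ : Measure E} [IsFiniteMeasure μ] {t : ℝ}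
    (ht : 0 < t) (h : MemLp id (ENNReal.ofReal t) μ) :
    ∫⁻ x, ENNReal.ofReal ((1 + ‖x‖) ^ t) ∂μ ≠ ∞ := by
  have h1 : MemLp (fun x : E => 1 + ‖x‖) (ENNReal.ofReal t) μ := by
    have h2 : MemLp (fun x : E => ‖x‖) (ENNReal.ofReal t) μ := h.norm
    exact (memLp_const (1 : ℝ)).add h2
  have h2 := lintegral_rpow_enorm_lt_top_of_eLpNorm_lt_top (by simpa using ht)
    ENNReal.ofReal_ne_top h1.2
  rw [ENNReal.toReal_ofReal ht.le] at h2
  refine ne_of_lt (lt_of_eq_of_lt (lintegral_congr fun x => ?_) h2)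
  have h0 : 0 ≤ 1 + ‖x‖ := by positivity
  rw [Real.enorm_eq_ofReal h0, ENNReal.ofReal_rpow_of_nonneg h0 ht.le]

variable {E : Type*} [NormedAddCommGroup E] [MeasurableSpace E] [BorelSpace E]

/-- A grid point is required because the distance to the empty set is ∞; this is why the one-step
estimates start at n = 1. -/
lemma distortion_ne_top {μ : Measure E} {p t : ℝ} (hp : 0 < p) (hpt : p ≤ t)
    (h : ∫⁻ x, ENNReal.ofReal ((1 + ‖x‖) ^ t) ∂μ ≠ ∞) {Γ : Set E} {a₀ : E} (ha₀ : a₀ ∈ Γ) :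
    distortion μ p Γ ≠ ∞ := by
  have hm : Measurable fun x : E => ENNReal.ofReal ((1 + ‖x‖) ^ t) := by fun_prop
  have h1 : distortion μ p Γ ≤
      ∫⁻ x, ENNReal.ofReal ((1 + ‖a₀‖) ^ p) * ENNReal.ofReal ((1 + ‖x‖) ^ t) ∂μ := by
    refine lintegral_mono fun x => ?_
    rw [infEDist_eq_ofReal ⟨a₀, ha₀⟩, ENNReal.ofReal_rpow_of_nonneg Metric.infDist_nonneg hp.le,
      ← ENNReal.ofReal_mul (by positivity)]
    refine ENNReal.ofReal_le_ofReal ?_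
    calc Metric.infDist x Γ ^ p ≤ ((1 + ‖a₀‖) * (1 + ‖x‖)) ^ p := by
          refine Real.rpow_le_rpow Metric.infDist_nonneg ((infDist_le_norm_add ha₀ x).trans ?_) hp.le
          nlinarith [norm_nonneg x, norm_nonneg a₀, mul_nonneg (norm_nonneg x) (norm_nonneg a₀)]
      _ = (1 + ‖a₀‖) ^ p * (1 + ‖x‖) ^ p := Real.mul_rpow (by positivity) (by positivity)
      _ ≤ (1 + ‖a₀‖) ^ p * (1 + ‖x‖) ^ t := by
          gcongr
          linarith [norm_nonneg x]
  rw [lintegral_const_mul _ hm] at h1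
  exact (h1.trans_lt (ENNReal.mul_lt_top ENNReal.ofReal_lt_top h.lt_top)).ne

end Moments

/-! ### The tail estimate and the criterion. -/

section Criterion

/-- Far from the origin an essentially radial density satisfies `φ(y) ≥ φ(c ξ)` for `y` in a ball
around `ξ` of radius proportional to the distance of `ξ` to the grid. -/
lemma exists_forall_closedBall_le {E : Type*} [NormedAddCommGroup E] [NormedSpace ℝ E]
    [FiniteDimensional ℝ E] {φ : E → ℝ} {n₀ : Seminorm ℝ E} (hn₀ : IsNorm n₀) {R : ℝ}
    (hR : 0 < R) {h : ℝ → ℝ} (hanti : AntitoneOn h (Set.Ioi R))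
    (hφ : ∀ ξ : E, R < n₀ ξ → φ ξ = h (n₀ ξ)) {c : ℝ} (hc : 1 < c) (a₀ : E) :
    ∃ R' ε, 0 < ε ∧ ε ≤ 1 / 3 ∧ ∀ Γ : Set E, a₀ ∈ Γ → ∀ ξ, R' < n₀ ξ →
      ∀ y ∈ Metric.closedBall ξ (ε * Metric.infDist ξ Γ), φ (c • ξ) ≤ φ y := by
  obtain ⟨c₁, hc₁, h₁⟩ := hn₀.exists_mul_norm_le
  obtain ⟨c₂, hc₂, h₂⟩ := exists_seminorm_le_mul_norm n₀
  -- If |y - ξ|₀ ≤ δ|ξ|₀, the bound 1/2 keeps |y|₀ ≥ |ξ|₀/2 > R, and the bound c - 1 keeps |y|₀ ≤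
  -- |cξ|₀. The choice of `ε` converts the ambient radius into this condition once c₁‖a₀‖ < |ξ|₀.
  set δ := min (1 / 2) (c - 1)
  have hδ : 0 < δ := lt_min (by norm_num) (by linarith)
  set ε := min (1 / 3) (δ * c₁ / (2 * c₂))
  have hε : 0 < ε := lt_min (by norm_num) (by positivity)
  refine ⟨max (2 * R) (c₁ * ‖a₀‖), ε, hε, min_le_left _ _, fun Γ ha₀ ξ hξ y hy => ?_⟩
  have hξR : 2 * R < n₀ ξ := (le_max_left _ _).trans_lt hξ
  have hξa : c₁ * ‖a₀‖ < n₀ ξ := (le_max_right _ _).trans_lt hξ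
  have hdist : n₀ (y - ξ) ≤ δ * n₀ ξ := by
    have h3 : ‖y - ξ‖ ≤ ε * (‖ξ‖ + ‖a₀‖) := by
      rw [Metric.mem_closedBall, dist_eq_norm] at hy
      exact hy.trans (mul_le_mul_of_nonneg_left (infDist_le_norm_add ha₀ ξ) hε.le)
    have h4 : ε * (2 * c₂) ≤ δ * c₁ := by
      rw [← le_div_iff₀ (by positivity)]
      exact min_le_right _ _
    have h5 : c₁ * (‖ξ‖ + ‖a₀‖) ≤ 2 * n₀ ξ := by linarith [h₁ ξ]
    have h6 : c₂ * (ε * (‖ξ‖ + ‖a₀‖)) * 2 ≤ δ * n₀ ξ * 2 := by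
      calc c₂ * (ε * (‖ξ‖ + ‖a₀‖)) * 2 = ε * (2 * c₂) * (‖ξ‖ + ‖a₀‖) := by ring
        _ ≤ δ * c₁ * (‖ξ‖ + ‖a₀‖) := by gcongr
        _ = δ * (c₁ * (‖ξ‖ + ‖a₀‖)) := by ring
        _ ≤ δ * (2 * n₀ ξ) := by gcongr
        _ = _ := by ring
    have h7 : c₂ * ‖y - ξ‖ ≤ c₂ * (ε * (‖ξ‖ + ‖a₀‖)) := by gcongr
    linarith [h₂ (y - ξ)]
  have hn : 0 ≤ n₀ ξ := apply_nonneg n₀ ξ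
  have hd1 : δ * n₀ ξ ≤ 1 / 2 * n₀ ξ := mul_le_mul_of_nonneg_right (min_le_left _ _) hn
  have hd2 : δ * n₀ ξ ≤ (c - 1) * n₀ ξ := mul_le_mul_of_nonneg_right (min_le_right _ _) hn
  have hup : n₀ y ≤ n₀ ξ + n₀ (y - ξ) := by
    simpa using map_add_le_add n₀ ξ (y - ξ)
  have hlo : n₀ ξ ≤ n₀ y + n₀ (y - ξ) := by
    have := map_sub_le_add n₀ y (y - ξ)
    simpa using this
  have hcξ : n₀ (c • ξ) = c * n₀ ξ := by
    rw [map_smul_eq_mul, Real.norm_of_nonneg (by linarith)]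
  have hyR : R < n₀ y := by linarith
  have hcR : R < n₀ (c • ξ) := by rw [hcξ]; nlinarith
  rw [hφ _ hcR, hφ _ hyR]
  exact hanti hyR hcR (by rw [hcξ]; linarith)

variable {E : Type*} [NormedAddCommGroup E] [NormedSpace ℝ E] [FiniteDimensional ℝ E]
  [MeasurableSpace E] [BorelSpace E]

/-- If a density is bounded below on small balls around `ξ`, then one greedy step gains a multiple
of `d(ξ, Γ) ^ (p + d)`. -/
lemma rpow_mul_le_of_density_ge (vol : Measure E) [vol.IsAddHaarMeasure] {μ : Measure E}
    {φ : E → ℝ} (hφ : IsDensity vol μ φ) {p : ℝ} (hp : 0 < p) {ε : ℝ} (hε : 0 < ε)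
    (hε3 : ε ≤ 1 / 3) {Γ Γ' : Set E} (hne : Γ.Nonempty) (hsub : Γ ⊆ Γ')
    (hfin : distortion μ p Γ ≠ ∞)
    (hmin : ∀ ξ, distortion μ p Γ' ≤ distortion μ p (Γ ∪ {ξ})) (ξ : E) (g : ℝ≥0∞)
    (hg : ∀ y ∈ Metric.closedBall ξ (ε * Metric.infDist ξ Γ), g ≤ ENNReal.ofReal (φ y)) :
    ENNReal.ofReal (1 - (1 / 2) ^ p) * (ENNReal.ofReal ((1 / 2) ^ p * ε ^ Module.finrank ℝ E) *
        vol (Metric.ball 0 1)) * (Metric.infEDist ξ Γ ^ (p + Module.finrank ℝ E) * g) ≤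
      distortion μ p Γ - distortion μ p Γ' := by
  have hfin' : distortion μ p Γ' ≠ ∞ := ((distortion_anti μ hp.le hsub).trans_lt hfin.lt_top).ne
  set d := Module.finrank ℝ E
  set r := Metric.infDist ξ Γ
  have hr : 0 ≤ r := Metric.infDist_nonneg
  set B := Metric.closedBall ξ (ε * r)
  have hB : MeasurableSet B := Metric.isClosed_closedBall.measurableSet
  have hμB : g * (ENNReal.ofReal ((ε * r) ^ d) * vol (Metric.ball 0 1)) ≤ μ B := by
    rw [hφ.2.2, withDensity_apply _ hB, ← Measure.addHaar_closedBall vol ξ (by positivity),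
      ← setLIntegral_const]
    exact setLIntegral_mono hφ.1.ennreal_ofReal hg
  have hint : ENNReal.ofReal ((r / 2) ^ p) * μ B ≤
      ∫⁻ x, {x | edist x ξ ≤ Metric.infEDist x Γ / 2}.indicator
        (fun x => Metric.infEDist x Γ ^ p) x ∂μ := by
    rw [← setLIntegral_const, ← lintegral_indicator hB]
    refine lintegral_mono fun x => ?_
    by_cases hx : x ∈ B
    · have hd : dist x ξ ≤ ε * r := hx
      have hrx : r ≤ Metric.infDist x Γ + dist ξ x := Metric.infDist_le_infDist_add_dist
      rw [dist_comm] at hrx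
      -- With ε ≤ 1/3 every x in `B` has distance at least 2r/3 to `Γ`, so |x - ξ| ≤ r/3 is at most
      -- half of it: `B` lies in the region of gain.
      have hεr : ε * r ≤ r / 3 := by nlinarith
      have hmem : x ∈ {x | edist x ξ ≤ Metric.infEDist x Γ / 2} := by
        rw [Set.mem_ofPred_eq, infEDist_eq_ofReal hne, edist_dist,
          show (2 : ℝ≥0∞) = ENNReal.ofReal 2 by simp, ← ENNReal.ofReal_div_of_pos two_pos]
        exact ENNReal.ofReal_le_ofReal (by linarith)
      rw [Set.indicator_of_mem hx, Set.indicator_of_mem hmem, infEDist_eq_ofReal hne,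
        ENNReal.ofReal_rpow_of_nonneg Metric.infDist_nonneg hp.le]
      exact ENNReal.ofReal_le_ofReal (Real.rpow_le_rpow (by positivity) (by linarith) hp.le)
    · rw [Set.indicator_of_notMem hx]
      exact zero_le
  have h1 : ENNReal.ofReal (1 - (1 / 2) ^ p) * (ENNReal.ofReal ((r / 2) ^ p) * μ B) ≤
      distortion μ p Γ - distortion μ p Γ' := by
    refine ENNReal.le_sub_of_add_le_right hfin' ?_
    rw [add_comm]
    refine le_trans ?_ (distortion_union_singleton_add_le μ hp Γ ξ)
    gcongr
    exact hmin ξ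
  refine le_trans (le_of_eq ?_) ((mul_le_mul_right (mul_le_mul_right hμB _) _).trans h1)
  have hrE : Metric.infEDist ξ Γ = ENNReal.ofReal r := infEDist_eq_ofReal hne ξ
  rw [hrE, ENNReal.rpow_add_of_nonneg _ _ hp.le (Nat.cast_nonneg _), ENNReal.rpow_natCast,
    ENNReal.ofReal_rpow_of_nonneg hr hp.le, mul_pow,
    show (r / 2) ^ p = (1 / 2) ^ p * r ^ p by
      rw [← Real.mul_rpow (by norm_num) hr]; congr 1; ring,
    ENNReal.ofReal_mul (by positivity), ENNReal.ofReal_mul (by positivity),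
    ENNReal.ofReal_mul (by positivity), ENNReal.ofReal_pow hr]
  ring

/-- The dilated moment condition forces the exponent to be less than `1`. -/
lemma HasDilatedMoment.lt_one [Nontrivial E] (vol : Measure E) [vol.IsAddHaarMeasure]
    {μ : Measure E} [IsProbabilityMeasure μ] {φ : E → ℝ} (hφ : IsDensity vol μ φ)
    (hrad : IsEssentiallyRadial φ) {s : ℝ} (hs : 0 < s) (hmom : HasDilatedMoment μ φ s) :
    s < 1 := by
  obtain ⟨n₀, R, h, hn₀, hR, hanti, -, hφr⟩ := hrad
  obtain ⟨c, hc, hint⟩ := hmom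
  obtain ⟨c₁, hc₁, h₁⟩ := hn₀.exists_mul_norm_le
  have hc0 : 0 < c := by linarith
  have hcont := continuous_seminorm n₀
  have hncξ : ∀ ξ : E, n₀ (c • ξ) = c * n₀ ξ := fun ξ => by
    rw [map_smul_eq_mul, Real.norm_of_nonneg hc0.le]
  have hG : Measurable fun ξ : E => ENNReal.ofReal (φ (c • ξ)) :=
    (hφ.1.comp (measurable_const_smul c)).ennreal_ofReal
  have hmeas : ∀ t : ℝ, MeasurableSet {ξ : E | t < n₀ ξ} := fun t =>
    measurableSet_lt measurable_const hcont.measurable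
  have hac : μ ≪ vol := by rw [hφ.2.2]; exact withDensity_absolutelyContinuous _ _
  -- Where φ(cξ) = 0 the negative power is ∞, which a finite integral allows only on a null set.
  have hne : ∀ᵐ ξ ∂μ, φ (c • ξ) ≠ 0 := by
    filter_upwards [ae_lt_top (hG.pow_const (-s)) hint.ne] with ξ hξ h0
    rw [h0, ENNReal.ofReal_zero, ENNReal.zero_rpow_of_neg (by linarith)] at hξ
    exact lt_irrefl _ hξ
  -- a null tail `{t < n₀}` would propagate inwards
  have hstep : ∀ t : ℝ, μ {ξ | t < n₀ ξ} = 0 → μ {ξ | t / c < n₀ ξ} = 0 := by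
    intro t ht
    rw [hφ.2.2, withDensity_apply _ (hmeas t), setLIntegral_eq_zero_iff (hmeas t)
      hφ.1.ennreal_ofReal] at ht
    have hq : Measure.QuasiMeasurePreserving (fun ξ : E => c • ξ) vol vol := by
      refine ⟨measurable_const_smul c, ?_⟩
      rw [Measure.map_addHaar_smul vol hc0.ne']
      exact Measure.smul_absolutelyContinuous
    have h3 := hac (hq.ae ht)
    have h4 : ∀ᵐ ξ ∂μ, ¬ (t / c < n₀ ξ) := by
      filter_upwards [h3, hne] with ξ hξ1 hξ2 hξ3
      have h5 : t < n₀ (c • ξ) := by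
        rw [hncξ, mul_comm]
        exact (div_lt_iff₀ hc0).mp hξ3
      have h6 : φ (c • ξ) ≤ 0 := by simpa using hξ1 h5
      exact hξ2 (le_antisymm h6 (hφ.2.1 _))
    simpa [ae_iff] using h4
  -- A null tail stays null when t is replaced by t/c^n → 0, so all mass would sit at the origin, a
  -- null set.
  have htail : ∀ t : ℝ, μ {ξ | t < n₀ ξ} ≠ 0 := by
    intro t ht
    have hpow : ∀ n : ℕ, μ {ξ | t / c ^ n < n₀ ξ} = 0 := by
      intro n
      induction n with
      | zero => simpa using ht
      | succ n ih =>
        have := hstep _ ih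
        rwa [div_div, ← pow_succ] at this
    have hlim : Tendsto (fun n : ℕ => t / c ^ n) atTop (nhds 0) := by
      have := (tendsto_pow_atTop_nhds_zero_of_lt_one (inv_nonneg.mpr hc0.le)
        (inv_lt_one_of_one_lt₀ hc)).const_mul t
      simpa [div_eq_mul_inv] using this
    have hcover : {ξ : E | ξ ≠ 0} ⊆ ⋃ n : ℕ, {ξ | t / c ^ n < n₀ ξ} := by
      intro ξ hξ
      have hpos : 0 < n₀ ξ := (apply_nonneg n₀ ξ).lt_of_ne' fun h0 => hξ (hn₀ ξ h0)
      obtain ⟨n, hn⟩ := (hlim.eventually (gt_mem_nhds hpos)).exists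
      exact Set.mem_iUnion.mpr ⟨n, hn⟩
    have h5 : μ {ξ : E | ξ ≠ 0} = 0 := measure_mono_null hcover (measure_iUnion_null hpow)
    have h6 : μ {(0 : E)} = 0 := hac (measure_singleton 0)
    have h7 : μ Set.univ = 0 := by
      refine measure_mono_null (fun ξ _ => ?_) (measure_union_null h5 h6)
      rcases eq_or_ne ξ 0 with h0 | h0
      · exact Or.inr h0
      · exact Or.inl h0
    simp at h7
  have hpos : ∀ ξ : E, R < n₀ ξ → 0 < φ ξ := by
    intro ξ hξ
    refine (hφ.2.1 ξ).lt_of_ne' fun h0 => htail (n₀ ξ) ?_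
    rw [hφ.2.2, withDensity_apply _ (hmeas _), setLIntegral_eq_zero_iff (hmeas _)
      hφ.1.ennreal_ofReal]
    refine Eventually.of_forall fun y hy => ?_
    have hy' : n₀ ξ < n₀ y := hy
    have hyR : R < n₀ y := hξ.trans hy'
    have : φ y ≤ φ ξ := by
      rw [hφr ξ hξ, hφr y hyR]
      exact hanti hξ hyR hy'.le
    rw [ENNReal.ofReal_eq_zero]
    linarith
  -- If s ≥ 1, then φ(ξ) φ(cξ)^(-s) ≥ φ(ξ)^(1-s) ≥ φ(z')^(1-s) > 0 on the set `T` of infinite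
  -- volume, contradicting the finite moment.
  by_contra hs1
  push Not at hs1
  obtain ⟨z, hz⟩ := exists_ne (0 : E)
  have hnz : 0 < n₀ z := (apply_nonneg n₀ z).lt_of_ne' fun h0 => hz (hn₀ z h0)
  let z' : E := ((R + 1) / n₀ z) • z
  have hz' : n₀ z' = R + 1 := by
    simp only [z']
    rw [map_smul_eq_mul, Real.norm_of_nonneg (by positivity), div_mul_cancel₀ _ hnz.ne']
  have hM : 0 < φ z' := hpos z' (by rw [hz']; linarith)
  let T : Set E := {ξ | R + 1 < n₀ ξ}
  have hvolT : vol T = ∞ := by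
    have h8 : (Set.univ : Set E) ⊆ T ∪ Metric.closedBall 0 ((R + 1) / c₁) := by
      intro ξ _
      by_cases hξ : R + 1 < n₀ ξ
      · exact Or.inl hξ
      · refine Or.inr ?_
        rw [mem_closedBall_zero_iff, le_div_iff₀ hc₁, mul_comm]
        linarith [h₁ ξ]
    have h9 := (measure_mono h8).trans (measure_union_le (μ := vol) _ _)
    rw [measure_univ_of_isAddLeftInvariant, top_le_iff, ENNReal.add_eq_top] at h9
    exact h9.resolve_right measure_closedBall_lt_top.ne
  have hge : ENNReal.ofReal (φ z' ^ (1 - s)) * vol T ≤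
      ∫⁻ ξ, ENNReal.ofReal (φ (c • ξ)) ^ (-s) ∂μ := by
    rw [hφ.2.2, lintegral_withDensity_eq_lintegral_mul _ hφ.1.ennreal_ofReal (hG.pow_const (-s)),
      ← setLIntegral_const]
    refine (setLIntegral_mono (hφ.1.ennreal_ofReal.mul (hG.pow_const (-s))) fun ξ hξ => ?_).trans
      (setLIntegral_le_lintegral T _)
    have hξ1 : R + 1 < n₀ ξ := hξ
    have hξR : R < n₀ ξ := by linarith
    have hcle : n₀ ξ ≤ n₀ (c • ξ) := by rw [hncξ]; nlinarith
    have hcR : R < n₀ (c • ξ) := by linarith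
    have hp1 : 0 < φ ξ := hpos ξ hξR
    have hp2 : 0 < φ (c • ξ) := hpos _ hcR
    have hle1 : φ (c • ξ) ≤ φ ξ := by
      rw [hφr _ hcR, hφr _ hξR]
      exact hanti hξR hcR hcle
    have hle2 : φ ξ ≤ φ z' := by
      rw [hφr _ hξR, hφr z' (by rw [hz']; linarith)]
      exact hanti (by rw [hz']; exact lt_add_one R) hξR (by rw [hz']; exact hξ1.le)
    rw [Pi.mul_apply, ENNReal.ofReal_rpow_of_pos hp2, ← ENNReal.ofReal_mul hp1.le]
    refine ENNReal.ofReal_le_ofReal ?_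
    calc φ z' ^ (1 - s) ≤ φ ξ ^ (1 - s) :=
          Real.rpow_le_rpow_of_nonpos hp1 hle2 (by linarith)
      _ = φ ξ * φ ξ ^ (-s) := by rw [sub_eq_add_neg, Real.rpow_add hp1, Real.rpow_one]
      _ ≤ φ ξ * φ (c • ξ) ^ (-s) := mul_le_mul_of_nonneg_left
          (Real.rpow_le_rpow_of_nonpos hp2 hle1 (by linarith)) hp1.le
  rw [hvolT, ENNReal.mul_top (by simp only [ne_eq, ENNReal.ofReal_eq_zero, not_le]; positivity),
    top_le_iff] at hge
  exact hint.ne hge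

/-- The part of the distortion of order `q` that is carried by the tail of the law. -/
lemma exists_setLIntegral_tail_le (vol : Measure E) [vol.IsAddHaarMeasure]
    {μ : Measure E} {φ : E → ℝ} (hφ : IsDensity vol μ φ) {n₀ : Seminorm ℝ E} (hn₀ : IsNorm n₀)
    {R : ℝ} (hR : 0 < R) {h : ℝ → ℝ} (hanti : AntitoneOn h (Set.Ioi R))
    (hφr : ∀ ξ : E, R < n₀ ξ → φ ξ = h (n₀ ξ)) {p q : ℝ} (hp : 0 < p) (hq : 0 < q)
    (hmom : HasDilatedMoment μ φ (q / (p + Module.finrank ℝ E))) (a₀ : E) :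
    ∃ (R' : ℝ) (K : ℝ≥0∞), K ≠ ∞ ∧ ∀ Γ Γ' : Set E, a₀ ∈ Γ → Γ ⊆ Γ' →
      distortion μ p Γ ≠ ∞ → (∀ ξ, distortion μ p Γ' ≤ distortion μ p (Γ ∪ {ξ})) →
      ∫⁻ x in {x | R' < n₀ x}, Metric.infEDist x Γ ^ q ∂μ
        ≤ K * (distortion μ p Γ - distortion μ p Γ') ^ (q / (p + Module.finrank ℝ E)) := by
  obtain ⟨c, hc, hint⟩ := hmom
  obtain ⟨R', ε, hε, hε3, hball⟩ := exists_forall_closedBall_le hn₀ hR hanti hφr hc a₀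
  set d := Module.finrank ℝ E
  have hpd : 0 < p + d := by positivity
  set s := q / (p + d)
  have hs : 0 < s := by positivity
  set κ : ℝ≥0∞ := ENNReal.ofReal (1 - (1 / 2) ^ p) * (ENNReal.ofReal ((1 / 2) ^ p * ε ^ d) *
        vol (Metric.ball 0 1))
  have hκ : κ ≠ 0 := mul_ne_zero (ofReal_one_sub_half_rpow_pos hp)
    (mul_ne_zero (by simp only [ne_eq, ENNReal.ofReal_eq_zero, not_le]; positivity)
      (Metric.measure_ball_pos vol 0 one_pos).ne')
  have hκ' : κ ≠ ∞ := ENNReal.mul_ne_top ENNReal.ofReal_ne_top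
    (ENNReal.mul_ne_top ENNReal.ofReal_ne_top measure_ball_lt_top.ne)
  have hG : Measurable fun ξ : E => ENNReal.ofReal (φ (c • ξ)) :=
    (hφ.1.comp (measurable_const_smul c)).ennreal_ofReal
  refine ⟨R', κ⁻¹ ^ s * ∫⁻ ξ, ENNReal.ofReal (φ (c • ξ)) ^ (-s) ∂μ,
    ENNReal.mul_ne_top (ENNReal.rpow_ne_top_of_nonneg hs.le (ENNReal.inv_ne_top.mpr hκ)) hint.ne,
    fun Γ Γ' ha₀ hsub hfin hmin => ?_⟩
  set Δ := distortion μ p Γ - distortion μ p Γ'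
  have hpt : ∀ᵐ x ∂μ, x ∈ {x | R' < n₀ x} → Metric.infEDist x Γ ^ q ≤
      (κ⁻¹ * Δ) ^ s * ENNReal.ofReal (φ (c • x)) ^ (-s) := by
    -- Finiteness of the moment makes φ(cx) nonzero almost everywhere, so the one-step gain can be
    -- divided by it.
    filter_upwards [ae_lt_top (hG.pow_const (-s)) hint.ne] with x hx hxR
    set g := ENNReal.ofReal (φ (c • x))
    have hg0 : g ≠ 0 := by
      intro h0
      rw [h0, ENNReal.zero_rpow_of_neg (by linarith)] at hx
      exact lt_irrefl _ hx
    have hg1 : g ≠ ∞ := ENNReal.ofReal_ne_top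
    have h1 := rpow_mul_le_of_density_ge vol hφ hp hε hε3 ⟨a₀, ha₀⟩ hsub hfin hmin x g
      fun y hy => ENNReal.ofReal_le_ofReal (hball Γ ha₀ x hxR y hy)
    have h2 : Metric.infEDist x Γ ^ (p + d) ≤ κ⁻¹ * Δ * g⁻¹ := by
      rw [← div_eq_mul_inv, ENNReal.le_div_iff_mul_le (Or.inl hg0) (Or.inl hg1),
        ← ENNReal.div_eq_inv_mul, ENNReal.le_div_iff_mul_le (Or.inl hκ) (Or.inl hκ'), mul_comm]
      exact h1
    have h3 : (p + d) * s = q := by simp only [s]; field_simp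
    rw [← h3, ENNReal.rpow_mul, ENNReal.rpow_neg, ← ENNReal.inv_rpow,
      ← ENNReal.mul_rpow_of_nonneg _ _ hs.le]
    exact ENNReal.rpow_le_rpow h2 hs.le
  have hmeas : MeasurableSet {x : E | R' < n₀ x} :=
    measurableSet_lt measurable_const (continuous_seminorm n₀).measurable
  calc ∫⁻ x in {x | R' < n₀ x}, Metric.infEDist x Γ ^ q ∂μ
      ≤ ∫⁻ x in {x | R' < n₀ x}, (κ⁻¹ * Δ) ^ s * ENNReal.ofReal (φ (c • x)) ^ (-s) ∂μ :=
        setLIntegral_mono_ae' hmeas hpt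
    _ ≤ ∫⁻ x, (κ⁻¹ * Δ) ^ s * ENNReal.ofReal (φ (c • x)) ^ (-s) ∂μ := setLIntegral_le_lintegral _ _
    _ = κ⁻¹ ^ s * (∫⁻ ξ, ENNReal.ofReal (φ (c • ξ)) ^ (-s) ∂μ) * Δ ^ s := by
        rw [lintegral_const_mul _ (hG.pow_const (-s)), ENNReal.mul_rpow_of_nonneg _ _ hs.le]
        ring

/-- The criterion for greedy sequences to be rate optimal. -/
theorem IsGreedySequence.isRateOptimal [Nontrivial E] (vol : Measure E) [vol.IsAddHaarMeasure]
    {Ω : Type*} [MeasurableSpace Ω] {P : Measure Ω} [IsProbabilityMeasure P] {X : Ω → E}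
    (hX : Measurable X) {p q δ : ℝ} (hp : 0 < p) (hq : 0 < q) (hδ : 0 < δ)
    (hLp : MemLp X (ENNReal.ofReal (p + δ)) P) {φ : E → ℝ} (hφ : IsDensity vol (P.map X) φ)
    (hrad : IsEssentiallyRadial φ)
    (hmom : HasDilatedMoment (P.map X) φ (q / (p + Module.finrank ℝ E))) {a : ℕ → E}
    (ha : IsGreedySequence P X p a) : IsRateOptimal P X q a := by
  have hprob : IsProbabilityMeasure (P.map X) := Measure.isProbabilityMeasure_map hX.aemeasurable
  have hd : 0 < (Module.finrank ℝ E : ℝ) := by exact_mod_cast Module.finrank_pos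
  have hs := hmom.lt_one vol hφ hrad (by positivity)
  have hgreedy := ha.distortion_le hX hp
  obtain ⟨n₀, R, h, hn₀, hR, hanti, -, hφr⟩ := hrad
  obtain ⟨R', K₁, hK₁, hb₁⟩ := exists_setLIntegral_tail_le vol hφ hn₀ hR hanti hφr hp hq hmom (a 0)
  set μ := P.map X
  set d := Module.finrank ℝ E
  have hqpd : q < p + d := by rwa [div_lt_one (by positivity)] at hs
  have hmem : MemLp id (ENNReal.ofReal (p + δ)) μ :=
    (memLp_map_measure_iff aestronglyMeasurable_id hX.aemeasurable).mpr hLp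
  have hmom1 := lintegral_one_add_norm_rpow_ne_top (by positivity) hmem
  have hfin : ∀ n, 1 ≤ n → distortion μ p (grid a n) ≠ ∞ := fun n hn =>
    distortion_ne_top hp (by linarith) hmom1 (zero_mem_grid a hn)
  -- the order `p`
  have e : (d + δ * d / p) * (p / (p + d - p)) = p + δ := by
    have : p + (d : ℝ) - p = d := by ring
    rw [this]
    field_simp
  -- This η > d makes the moment exponent ηp/d in Hölder's inequality equal to p + δ.
  obtain ⟨K₂, hK₂, hb₂⟩ := exists_setLIntegral_rpow_le vol (η := d + δ * d / p) hp
    (lt_add_of_pos_right _ (by positivity)) hp (lt_add_of_pos_right _ hd) (a 0) μ Set.univ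
    (by rw [e, setLIntegral_univ]; exact hmom1)
  -- the order `q` on a ball
  obtain ⟨c₁, hc₁, h₁⟩ := hn₀.exists_mul_norm_le
  have hT : MeasurableSet {x : E | R' < n₀ x} :=
    measurableSet_lt measurable_const (continuous_seminorm n₀).measurable
  -- The complement of the tail is bounded, so every moment is finite there and any η > d serves.
  obtain ⟨K₃, hK₃, hb₃⟩ := exists_setLIntegral_rpow_le vol (η := d + 1) hp
    (lt_add_of_pos_right _ one_pos) hq hqpd (a 0) μ {x | R' < n₀ x}ᶜ (by
      set t := (d + 1 : ℝ) * (q / (p + d - q))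
      have ht : 0 ≤ t := by
        have : 0 < p + d - q := by linarith
        positivity
      refine ne_of_lt ((setLIntegral_mono' (g := fun _ => ENNReal.ofReal ((1 + R' / c₁) ^ t))
        hT.compl fun x hx => ENNReal.ofReal_le_ofReal ?_).trans_lt ?_)
      · refine Real.rpow_le_rpow (by positivity) ?_ ht
        have hx' : n₀ x ≤ R' := not_lt.mp hx
        have : ‖x‖ ≤ R' / c₁ := by
          rw [le_div_iff₀ hc₁, mul_comm]
          exact (h₁ x).trans hx'
        linarith
      · rw [setLIntegral_const]
        exact ENNReal.mul_lt_top ENNReal.ofReal_lt_top (measure_lt_top _ _))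
  have main := limsup_rpow_mul_distortion_lt_top μ hp hq hd a hfin hK₂
    (ENNReal.add_ne_top.mpr ⟨hK₁, hK₃⟩)
    (fun n hn => by
      have := hb₂ (grid a n) (grid a (n + 1)) (zero_mem_grid a hn) (grid_mono a n.le_succ)
        (hfin n hn) (hgreedy n)
      rwa [setLIntegral_univ] at this)
    (fun n hn => by
      have h3 := hb₁ (grid a n) (grid a (n + 1)) (zero_mem_grid a hn) (grid_mono a n.le_succ)
        (hfin n hn) (hgreedy n)
      have h4 := hb₃ (grid a n) (grid a (n + 1)) (zero_mem_grid a hn) (grid_mono a n.le_succ)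
        (hfin n hn) (hgreedy n)
      rw [distortion, ← lintegral_add_compl _ hT, add_mul]
      exact add_le_add h3 h4)
  simpa only [IsRateOptimal, quantError_eq_distortion P hX] using main

end Criterion

/-! ### Bounds for the radial profile r^c exp(-a r^b). -/

section RealBounds

lemma exists_rpow_mul_exp_neg_le {b k β : ℝ} (hb : 0 < b) (hk : 0 ≤ k) (hβ : 0 < β) :
    ∃ C, 0 < C ∧ ∀ r : ℝ, 0 ≤ r → r ^ k * Real.exp (-β * r ^ b) ≤ C := by
  have hlim := tendsto_rpow_mul_exp_neg_mul_atTop_nhds_zero (k / b) β hβ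
  obtain ⟨Y, hY⟩ := eventually_atTop.mp (hlim.eventually (gt_mem_nhds one_pos))
  have hkb : 0 ≤ k / b := by positivity
  refine ⟨1 + |Y| ^ (k / b), by positivity, fun r hr => ?_⟩
  have hrb : 0 ≤ r ^ b := by positivity
  have e : r ^ k = (r ^ b) ^ (k / b) := by
    rw [← Real.rpow_mul hr]
    congr 1
    field_simp
  rw [e]
  have hYk : 0 ≤ |Y| ^ (k / b) := by positivity
  rcases le_total Y (r ^ b) with h | h
  · linarith [hY _ h]
  · have h1 : (r ^ b) ^ (k / b) ≤ |Y| ^ (k / b) :=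
      Real.rpow_le_rpow hrb (h.trans (le_abs_self Y)) hkb
    have h2 : Real.exp (-β * r ^ b) ≤ 1 := by
      rw [Real.exp_le_one_iff]
      nlinarith
    nlinarith [Real.exp_pos (-β * r ^ b)]

/-- The logarithmic derivative is (c - a b r^b)/r, and R is chosen so that |c| ≤ a b r^b beyond it.
Writing r' = r e^l and using e^x ≥ 1 + x replaces differentiation. -/
lemma antitoneOn_rpow_mul_exp_neg {κ a b : ℝ} (hκ : 0 < κ) (ha : 0 < a) (hb : 0 < b) (c : ℝ) :
    ∃ R, 0 < R ∧ AntitoneOn (fun r : ℝ => κ * r ^ c * Real.exp (-a * r ^ b)) (Set.Ioi R) := by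
  refine ⟨(|c| / (a * b) + 1) ^ (1 / b), by positivity, fun r hr r' _ hrr' => ?_⟩
  have hr1 : (|c| / (a * b) + 1) ^ (1 / b) < r := hr
  have hr0 : 0 < r := lt_trans (by positivity) hr1
  have hr0' : 0 < r' := hr0.trans_le hrr'
  have h1 : |c| ≤ a * b * r ^ b := by
    have h2 := Real.rpow_le_rpow (by positivity) hr1.le hb.le
    rw [← Real.rpow_mul (by positivity), one_div_mul_cancel hb.ne', Real.rpow_one] at h2
    have h3 : |c| / (a * b) ≤ r ^ b := by linarith
    rwa [div_le_iff₀ (by positivity), mul_comm] at h3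
  set l := Real.log (r' / r)
  have hl : 0 ≤ l := Real.log_nonneg ((one_le_div hr0).mpr hrr')
  have e : r' = r * Real.exp l := by
    rw [Real.exp_log (by positivity)]
    field_simp
  have h4 : c * l ≤ a * r' ^ b - a * r ^ b := by
    rw [e, Real.mul_rpow hr0.le (Real.exp_pos _).le, ← Real.exp_mul]
    have h5 := Real.add_one_le_exp (l * b)
    have h6 : 0 < a * r ^ b := by positivity
    have h7 : c * l ≤ a * b * r ^ b * l := mul_le_mul_of_nonneg_right ((le_abs_self c).trans h1) hl
    nlinarith [mul_le_mul_of_nonneg_left h5 h6.le]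
  have h8 : r' ^ c = r ^ c * Real.exp (c * l) := by
    rw [e, Real.mul_rpow hr0.le (Real.exp_pos _).le, ← Real.exp_mul, mul_comm l c]
  calc κ * r' ^ c * Real.exp (-a * r' ^ b)
      = κ * r ^ c * Real.exp (c * l + -a * r' ^ b) := by rw [h8, Real.exp_add]; ring
    _ ≤ κ * r ^ c * Real.exp (-a * r ^ b) := by
        gcongr
        linarith

end RealBounds

/-! ### Centred hyper-exponential laws satisfy the hypotheses. -/

section HyperExponential

/-- Integrability of the profile is read off from the finite mass of `μ`, so no radial integral has
to be computed. -/
lemma lintegral_hyperExp_ne_top {E : Type*} [AddCommGroup E] [Module ℝ E] [MeasurableSpace E]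
    {n₀ : Seminorm ℝ E} {κ a b c : ℝ} {vol μ : Measure E} [IsFiniteMeasure μ] (hκ : 0 < κ)
    (hφ : IsDensity vol μ (hyperExpDensity n₀ 0 κ a b c)) :
    ∫⁻ ξ, ENNReal.ofReal ((n₀ ξ) ^ c * Real.exp (-a * (n₀ ξ) ^ b)) ∂vol ≠ ∞ := by
  have h1 : μ Set.univ ≠ ∞ := measure_ne_top _ _
  rw [hφ.2.2, withDensity_apply _ MeasurableSet.univ, setLIntegral_univ] at h1
  have h2 : ∀ ξ : E, ENNReal.ofReal (hyperExpDensity n₀ 0 κ a b c ξ) = ENNReal.ofReal κ *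
      ENNReal.ofReal ((n₀ ξ) ^ c * Real.exp (-a * (n₀ ξ) ^ b)) := fun ξ => by
    rw [← ENNReal.ofReal_mul hκ.le, hyperExpDensity, sub_zero, mul_assoc]
  simp_rw [h2] at h1
  rw [lintegral_const_mul' _ _ ENNReal.ofReal_ne_top] at h1
  intro h3
  rw [h3, ENNReal.mul_top (by simpa using hκ)] at h1
  exact h1 rfl

lemma isEssentiallyRadial_hyperExp {E : Type*} [AddCommGroup E] [Module ℝ E]
    {n₀ : Seminorm ℝ E} {κ a b c : ℝ} (hn₀ : IsNorm n₀) (hκ : 0 < κ) (ha : 0 < a) (hb : 0 < b) :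
    IsEssentiallyRadial (hyperExpDensity n₀ 0 κ a b c) := by
  obtain ⟨R, hR, hanti⟩ := antitoneOn_rpow_mul_exp_neg hκ ha hb c
  refine ⟨n₀, R, _, hn₀, hR, hanti, fun r hr => ?_, fun ξ _ => ?_⟩
  · have : 0 < r := hR.trans hr
    positivity
  · simp only [hyperExpDensity, sub_zero]

variable {E : Type*} [NormedAddCommGroup E] [NormedSpace ℝ E] [FiniteDimensional ℝ E]
  [MeasurableSpace E] [BorelSpace E]

lemma measurable_radial {n₀ : Seminorm ℝ E} {f : ℝ → ℝ} (hf : Measurable f) :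
    Measurable fun ξ : E => ENNReal.ofReal (f (n₀ ξ)) :=
  (hf.comp (continuous_seminorm n₀).measurable).ennreal_ofReal

lemma lintegral_comp_smul_ne_top (vol : Measure E) [vol.IsAddHaarMeasure] {f : E → ℝ≥0∞}
    (hf : Measurable f) (h : ∫⁻ x, f x ∂vol ≠ ∞) {t : ℝ} (ht : 0 < t) :
    ∫⁻ x, f (t • x) ∂vol ≠ ∞ := by
  rw [← lintegral_map hf (measurable_const_smul t), Measure.map_addHaar_smul vol ht.ne',
    lintegral_smul_measure]
  exact ENNReal.mul_ne_top ENNReal.ofReal_ne_top h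

/-- If `|ξ|₀^c exp(-a |ξ|₀^b)` is integrable for one `a`, then so is `|ξ|₀^γ exp(-α |ξ|₀^b)` for all
`α > 0` and `γ ≥ min c 0`. -/
lemma lintegral_rpow_mul_exp_neg_ne_top [Nontrivial E] (vol : Measure E) [vol.IsAddHaarMeasure]
    {n₀ : Seminorm ℝ E} (hn₀ : IsNorm n₀) {a b c : ℝ} (ha : 0 < a) (hb : 0 < b)
    (hint : ∫⁻ ξ, ENNReal.ofReal ((n₀ ξ) ^ c * Real.exp (-a * (n₀ ξ) ^ b)) ∂vol ≠ ∞)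
    {α γ : ℝ} (hα : 0 < α) (hγ : min c 0 ≤ γ) :
    ∫⁻ ξ, ENNReal.ofReal ((n₀ ξ) ^ γ * Real.exp (-α * (n₀ ξ) ^ b)) ∂vol ≠ ∞ := by
  have hmeas : ∀ γ α : ℝ, Measurable fun ξ : E =>
      ENNReal.ofReal ((n₀ ξ) ^ γ * Real.exp (-α * (n₀ ξ) ^ b)) := fun γ α =>
    measurable_radial (f := fun r => r ^ γ * Real.exp (-α * r ^ b)) (by fun_prop)
  have hpos : ∀ᵐ ξ ∂vol, 0 < n₀ ξ := by
    have h0 : ∀ᵐ ξ ∂vol, ξ ∉ ({0} : Set E) := measure_eq_zero_iff_ae_notMem.mp (measure_singleton 0)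
    filter_upwards [h0] with ξ hξ
    exact (apply_nonneg n₀ ξ).lt_of_ne' fun h => hξ (hn₀ ξ h)
  -- scaling gives the exponent `c` with an arbitrary rate
  have hscale : ∀ α : ℝ, 0 < α →
      ∫⁻ ξ, ENNReal.ofReal ((n₀ ξ) ^ c * Real.exp (-α * (n₀ ξ) ^ b)) ∂vol ≠ ∞ := by
    intro α hα
    set t := (α / a) ^ (1 / b)
    have ht : 0 < t := by positivity
    have htb : t ^ b = α / a := by
      rw [← Real.rpow_mul (by positivity), one_div_mul_cancel hb.ne', Real.rpow_one]
    have h1 := lintegral_comp_smul_ne_top vol (hmeas c a) hint ht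
    have h2 : ∀ ξ : E, ENNReal.ofReal ((n₀ ξ) ^ c * Real.exp (-α * (n₀ ξ) ^ b)) =
        ENNReal.ofReal ((t ^ c)⁻¹) *
          ENNReal.ofReal ((n₀ (t • ξ)) ^ c * Real.exp (-a * (n₀ (t • ξ)) ^ b)) := by
      intro ξ
      have hn : 0 ≤ n₀ ξ := apply_nonneg n₀ ξ
      rw [← ENNReal.ofReal_mul (by positivity), map_smul_eq_mul, Real.norm_of_nonneg ht.le,
        Real.mul_rpow ht.le hn, Real.mul_rpow ht.le hn, htb]
      congr 1
      have e : -a * (α / a * n₀ ξ ^ b) = -α * n₀ ξ ^ b := by field_simp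
      have ht2 : 0 < t ^ c := by positivity
      rw [e]
      field_simp
    simp_rw [h2]
    rw [lintegral_const_mul' _ _ ENNReal.ofReal_ne_top]
    exact ENNReal.mul_ne_top ENNReal.ofReal_ne_top h1
  -- If γ ≥ c, half of the exponential absorbs the excess power. Otherwise γ ≥ 0, so the integrand
  -- is at most 1 on the unit ball and is dominated by the power c outside.
  rcases le_or_gt c γ with hcγ | hcγ
  · obtain ⟨C, hC, hCb⟩ := exists_rpow_mul_exp_neg_le hb (sub_nonneg.mpr hcγ) (half_pos hα)
    have h3 : ∫⁻ ξ, ENNReal.ofReal ((n₀ ξ) ^ γ * Real.exp (-α * (n₀ ξ) ^ b)) ∂vol ≤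
        ∫⁻ ξ, ENNReal.ofReal C *
          ENNReal.ofReal ((n₀ ξ) ^ c * Real.exp (-(α / 2) * (n₀ ξ) ^ b)) ∂vol := by
      refine lintegral_mono_ae ?_
      filter_upwards [hpos] with ξ hξ
      rw [← ENNReal.ofReal_mul hC.le]
      refine ENNReal.ofReal_le_ofReal ?_
      calc (n₀ ξ) ^ γ * Real.exp (-α * (n₀ ξ) ^ b)
          = ((n₀ ξ) ^ (γ - c) * Real.exp (-(α / 2) * (n₀ ξ) ^ b)) *
            ((n₀ ξ) ^ c * Real.exp (-(α / 2) * (n₀ ξ) ^ b)) := by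
            have e1 : (n₀ ξ) ^ γ = (n₀ ξ) ^ (γ - c) * (n₀ ξ) ^ c := by
              rw [← Real.rpow_add hξ]; congr 1; ring
            have e2 : Real.exp (-α * (n₀ ξ) ^ b) =
                Real.exp (-(α / 2) * (n₀ ξ) ^ b) * Real.exp (-(α / 2) * (n₀ ξ) ^ b) := by
              rw [← Real.exp_add]; congr 1; ring
            rw [e1, e2]
            ring
        _ ≤ C * ((n₀ ξ) ^ c * Real.exp (-(α / 2) * (n₀ ξ) ^ b)) :=
            mul_le_mul_of_nonneg_right (hCb _ hξ.le) (by positivity)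
    rw [lintegral_const_mul _ (hmeas _ _)] at h3
    exact (h3.trans_lt (ENNReal.mul_lt_top ENNReal.ofReal_lt_top (hscale _ (half_pos hα)).lt_top)).ne
  · have hγ0 : 0 ≤ γ := by
      rcases min_le_iff.mp hγ with h | h
      · exact absurd h hcγ.not_ge
      · exact h
    obtain ⟨c₁, hc₁, h₁⟩ := hn₀.exists_mul_norm_le
    have hB : MeasurableSet {ξ : E | n₀ ξ ≤ 1} :=
      measurableSet_le (continuous_seminorm n₀).measurable measurable_const
    have hvol : vol {ξ : E | n₀ ξ ≤ 1} < ∞ := by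
      refine (measure_mono fun ξ (hξ : n₀ ξ ≤ 1) => ?_).trans_lt
        (measure_closedBall_lt_top (x := (0 : E)) (r := 1 / c₁))
      rw [mem_closedBall_zero_iff, le_div_iff₀ hc₁, mul_comm]
      exact (h₁ ξ).trans hξ
    have h3 : ∫⁻ ξ, ENNReal.ofReal ((n₀ ξ) ^ γ * Real.exp (-α * (n₀ ξ) ^ b)) ∂vol ≤
        ∫⁻ ξ, {ξ : E | n₀ ξ ≤ 1}.indicator 1 ξ +
          ENNReal.ofReal ((n₀ ξ) ^ c * Real.exp (-α * (n₀ ξ) ^ b)) ∂vol := by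
      refine lintegral_mono fun ξ => ?_
      have hn : 0 ≤ n₀ ξ := apply_nonneg n₀ ξ
      rcases le_or_gt (n₀ ξ) 1 with h | h
      · rw [Set.indicator_of_mem (by exact h)]
        refine le_add_right ?_
        rw [Pi.one_apply, ← ENNReal.ofReal_one]
        refine ENNReal.ofReal_le_ofReal (mul_le_one₀ (Real.rpow_le_one hn h hγ0)
          (Real.exp_pos _).le ?_)
        rw [Real.exp_le_one_iff, neg_mul, neg_nonpos]
        positivity
      · refine le_add_left (ENNReal.ofReal_le_ofReal ?_)
        gcongr
        exact h.le
    rw [lintegral_add_right _ (hmeas _ _), lintegral_indicator_one hB] at h3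
    exact (h3.trans_lt (ENNReal.add_lt_top.mpr ⟨hvol, (hscale α hα).lt_top⟩)).ne

variable {n₀ : Seminorm ℝ E} {κ a b c : ℝ} {vol μ : Measure E} [vol.IsAddHaarMeasure]

lemma memLp_id_of_hyperExp [Nontrivial E] [IsFiniteMeasure μ] (hn₀ : IsNorm n₀) (hκ : 0 < κ)
    (ha : 0 < a) (hb : 0 < b) (hφ : IsDensity vol μ (hyperExpDensity n₀ 0 κ a b c)) {t : ℝ}
    (ht : 0 < t) : MemLp id (ENNReal.ofReal t) μ := by
  refine ⟨aestronglyMeasurable_id, ?_⟩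
  rw [eLpNorm_lt_top_iff_lintegral_rpow_enorm_lt_top (by simpa using ht) ENNReal.ofReal_ne_top,
    ENNReal.toReal_ofReal ht.le, hφ.2.2, lintegral_withDensity_eq_lintegral_mul _
    hφ.1.ennreal_ofReal (by fun_prop)]
  obtain ⟨c₁, hc₁, h₁⟩ := hn₀.exists_mul_norm_le
  have hint := lintegral_rpow_mul_exp_neg_ne_top vol hn₀ ha hb (lintegral_hyperExp_ne_top hκ hφ) ha
    (γ := c + t) ((min_le_left _ _).trans (by linarith))
  have h0 : ∀ᵐ ξ ∂vol, ξ ∉ ({0} : Set E) := measure_eq_zero_iff_ae_notMem.mp (measure_singleton 0)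
  refine lt_of_le_of_lt (lintegral_mono_ae (g := fun ξ => ENNReal.ofReal (κ * (c₁⁻¹) ^ t) *
    ENNReal.ofReal ((n₀ ξ) ^ (c + t) * Real.exp (-a * (n₀ ξ) ^ b))) ?_) ?_
  · filter_upwards [h0] with ξ hξ
    have hn : 0 < n₀ ξ := (apply_nonneg n₀ ξ).lt_of_ne' fun h => hξ (hn₀ ξ h)
    have h2 : ‖ξ‖ ^ t ≤ (c₁⁻¹) ^ t * (n₀ ξ) ^ t := by
      rw [← Real.mul_rpow (by positivity) hn.le]
      refine Real.rpow_le_rpow (norm_nonneg _) ?_ ht.le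
      rw [inv_mul_eq_div, le_div_iff₀ hc₁, mul_comm]
      exact h₁ ξ
    rw [Pi.mul_apply, id, ← ofReal_norm, ENNReal.ofReal_rpow_of_nonneg (norm_nonneg _)
      ht.le, ← ENNReal.ofReal_mul (hφ.2.1 ξ), ← ENNReal.ofReal_mul (by positivity)]
    refine ENNReal.ofReal_le_ofReal ?_
    rw [hyperExpDensity, sub_zero, Real.rpow_add hn]
    calc κ * n₀ ξ ^ c * Real.exp (-a * n₀ ξ ^ b) * ‖ξ‖ ^ t
        ≤ κ * n₀ ξ ^ c * Real.exp (-a * n₀ ξ ^ b) * ((c₁⁻¹) ^ t * (n₀ ξ) ^ t) := by gcongr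
      _ = _ := by ring
  · rw [lintegral_const_mul' _ _ ENNReal.ofReal_ne_top]
    exact ENNReal.mul_lt_top ENNReal.ofReal_lt_top hint.lt_top

/-- Up to a constant, φ(ξ) φ(lξ)^(-s) is |ξ|₀^(c(1-s)) exp(-a(1 - s l^b)|ξ|₀^b); since s < 1, some l
> 1 still has s l^b < 1. -/
lemma hasDilatedMoment_hyperExp [Nontrivial E] [IsFiniteMeasure μ] (hn₀ : IsNorm n₀) (hκ : 0 < κ)
    (ha : 0 < a) (hb : 0 < b) (hφ : IsDensity vol μ (hyperExpDensity n₀ 0 κ a b c)) {s : ℝ}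
    (hs : 0 < s) (hs1 : s < 1) : HasDilatedMoment μ (hyperExpDensity n₀ 0 κ a b c) s := by
  -- Chosen so that s l^b = √s.
  set l : ℝ := s ^ (-(1 / (2 * b)))
  have hl : 1 < l := Real.one_lt_rpow_of_pos_of_lt_one_of_neg hs hs1 (by
    rw [neg_lt_zero]; positivity)
  have hl0 : 0 < l := by linarith
  have hlb : s * l ^ b < 1 := by
    have e : s * l ^ b = s ^ (1 / 2 : ℝ) := by
      rw [← Real.rpow_mul hs.le]
      nth_rewrite 1 [← Real.rpow_one s]
      rw [← Real.rpow_add hs]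
      congr 1
      field_simp
      norm_num
    rw [e]
    exact Real.rpow_lt_one hs.le hs1 (by norm_num)
  refine ⟨l, hl, ?_⟩
  have hG : Measurable fun ξ : E =>
      ENNReal.ofReal (hyperExpDensity n₀ 0 κ a b c (l • ξ)) ^ (-s) :=
    (hφ.1.comp (measurable_const_smul l)).ennreal_ofReal.pow_const _
  rw [hφ.2.2, lintegral_withDensity_eq_lintegral_mul _ hφ.1.ennreal_ofReal hG]
  have hγ : min c 0 ≤ c * (1 - s) := by
    rcases le_total c 0 with h | h
    · rw [min_eq_left h]; nlinarith
    · rw [min_eq_right h]; exact mul_nonneg h (by linarith)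
  have hint := lintegral_rpow_mul_exp_neg_ne_top vol hn₀ ha hb (lintegral_hyperExp_ne_top hκ hφ)
    (α := a * (1 - s * l ^ b)) (mul_pos ha (by linarith)) hγ
  have h0 : ∀ᵐ ξ ∂vol, ξ ∉ ({0} : Set E) := measure_eq_zero_iff_ae_notMem.mp (measure_singleton 0)
  have hcongr : ∀ᵐ ξ ∂vol, ((fun ξ => ENNReal.ofReal (hyperExpDensity n₀ 0 κ a b c ξ)) *
      fun ξ => ENNReal.ofReal (hyperExpDensity n₀ 0 κ a b c (l • ξ)) ^ (-s)) ξ =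
      ENNReal.ofReal (κ ^ (1 - s) * l ^ (-(c * s))) * ENNReal.ofReal ((n₀ ξ) ^ (c * (1 - s)) *
        Real.exp (-(a * (1 - s * l ^ b)) * (n₀ ξ) ^ b)) := by
    filter_upwards [h0] with ξ hξ
    have hn : 0 < n₀ ξ := (apply_nonneg n₀ ξ).lt_of_ne' fun h => hξ (hn₀ ξ h)
    have hnl : n₀ (l • ξ) = l * n₀ ξ := by
      rw [map_smul_eq_mul, Real.norm_of_nonneg hl0.le]
    rw [Pi.mul_apply, hyperExpDensity, hyperExpDensity, sub_zero, sub_zero, hnl,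
      ENNReal.ofReal_rpow_of_pos (by positivity), ← ENNReal.ofReal_mul (by positivity),
      ← ENNReal.ofReal_mul (by positivity)]
    congr 1
    rw [Real.mul_rpow (by positivity) (Real.exp_pos _).le, Real.mul_rpow hκ.le (by positivity),
      ← Real.exp_mul, ← Real.rpow_mul (by positivity), Real.mul_rpow hl0.le hn.le,
      Real.mul_rpow hl0.le hn.le, sub_eq_add_neg 1 s, Real.rpow_add hκ, Real.rpow_one, mul_add,
      mul_one, Real.rpow_add hn, mul_neg,
      show -(a * (1 - s * l ^ b)) * n₀ ξ ^ b =
        -a * n₀ ξ ^ b + -(-a * (l ^ b * n₀ ξ ^ b) * s) by ring, Real.exp_add]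
    ring_nf
  rw [lintegral_congr_ae hcongr, lintegral_const_mul' _ _ ENNReal.ofReal_ne_top]
  exact ENNReal.mul_lt_top ENNReal.ofReal_lt_top hint.lt_top

end HyperExponential

/-! ### Non-degenerate normal laws are hyper-exponential. -/

section Gaussian

open scoped RealInnerProductSpace

/-- The standard normal law on a Euclidean space, by its density, has the expected characteristic
function. -/
lemma charFun_withDensity_gaussian {F : Type*} [NormedAddCommGroup F] [InnerProductSpace ℝ F]
    [FiniteDimensional ℝ F] [MeasurableSpace F] [BorelSpace F] (t : F) :
    charFun ((volume : Measure F).withDensity fun y => ENNReal.ofReal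
      ((2 * Real.pi) ^ (-(Module.finrank ℝ F / 2 : ℝ)) * Real.exp (-(1 / 2) * ‖y‖ ^ 2))) t =
      Complex.exp (-(‖t‖ ^ 2 / 2)) := by
  set k : ℝ := (2 * Real.pi) ^ (-(Module.finrank ℝ F / 2 : ℝ))
  have hk : 0 < k := by positivity
  rw [charFun_apply, integral_withDensity_eq_integral_toReal_smul (by fun_prop)
    (Eventually.of_forall fun _ => ENNReal.ofReal_lt_top)]
  have h1 : ∀ y : F, (ENNReal.ofReal (k * Real.exp (-(1 / 2) * ‖y‖ ^ 2))).toReal •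
      Complex.exp (⟪y, t⟫ * Complex.I) =
      (k : ℂ) * Complex.exp (-(1 / 2 : ℂ) * ‖y‖ ^ 2 + Complex.I * ⟪t, y⟫) := by
    intro y
    rw [ENNReal.toReal_ofReal (by positivity), Complex.real_smul, Complex.exp_add, real_inner_comm]
    push_cast
    ring_nf
  simp_rw [h1]
  rw [integral_const_mul, GaussianFourier.integral_cexp_neg_mul_sq_norm_add (by norm_num)]
  have h2 : (k : ℂ) * ((Real.pi : ℂ) / (1 / 2)) ^ (Module.finrank ℝ F / 2 : ℂ) = 1 := by
    have h3 : ((Real.pi : ℂ) / (1 / 2)) ^ (Module.finrank ℝ F / 2 : ℂ) =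
        (((2 * Real.pi) ^ (Module.finrank ℝ F / 2 : ℝ) : ℝ) : ℂ) := by
      rw [Complex.ofReal_cpow (by positivity)]
      push_cast
      congr 1
      ring
    rw [h3, ← Complex.ofReal_mul, ← Real.rpow_add (by positivity)]
    simp
  rw [← mul_assoc, h2, one_mul, Complex.I_sq]
  congr 1
  ring

variable {E : Type*} [NormedAddCommGroup E] [NormedSpace ℝ E] [FiniteDimensional ℝ E]
  [MeasurableSpace E] [BorelSpace E]

/-- The covariance of an absolutely continuous Gaussian law is positive definite. -/
lemma covarianceBilinDual_self_pos (vol : Measure E) [vol.IsAddHaarMeasure] {ν : Measure E}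
    [IsGaussian ν] (hν : ν ≪ vol) {L : StrongDual ℝ E} (hL : L ≠ 0) :
    0 < covarianceBilinDual ν L L := by
  have hmem : MemLp id 2 ν := IsGaussian.memLp_two_id
  rw [covarianceBilinDual_self_eq_variance hmem]
  -- Zero variance would concentrate `ν` on a level set of `L`, a translate of its kernel and hence
  -- Haar-null.
  refine (variance_nonneg _ _).lt_of_ne' fun h0 => ?_
  have hae := ae_eq_integral_of_variance_eq_zero (IsGaussian.memLp_dual ν L 2 (by norm_num)) h0
  obtain ⟨x₀, hx₀⟩ : ∃ x₀, L x₀ = ν[L] := by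
    refine LinearMap.surjective (f := (L : E →ₗ[ℝ] ℝ)) (fun h => hL ?_) _
    ext x
    exact LinearMap.congr_fun h x
  have hker : vol (LinearMap.ker (L : E →ₗ[ℝ] ℝ) : Set E) = 0 := by
    refine Measure.addHaar_submodule vol _ fun htop => hL ?_
    ext x
    have : x ∈ LinearMap.ker (L : E →ₗ[ℝ] ℝ) := by rw [htop]; trivial
    simpa using this
  have hset : vol {x | L x = ν[L]} = 0 := by
    have h2 := measure_preimage_add vol (-x₀) (LinearMap.ker (L : E →ₗ[ℝ] ℝ) : Set E)
    rw [hker] at h2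
    refine measure_mono_null (fun x hx => ?_) h2
    have hx' : L x = ν[L] := hx
    simp [hx', hx₀]
  have h3 : ν {x | L x = ν[L]} = 0 := hν hset
  have h4 : ∀ᵐ x ∂ν, False := by
    filter_upwards [hae, measure_eq_zero_iff_ae_notMem.mp h3] with x h5 h6
    exact h6 h5
  have := IsProbabilityMeasure.ne_zero ν
  exact this (by simpa using h4)

/-- Coordinates in which a Gaussian law with positive definite covariance is standard. -/
lemma exists_equiv_variance_eq (ν : Measure E) [IsGaussian ν]
    (hpos : ∀ L : StrongDual ℝ E, L ≠ 0 → 0 < covarianceBilinDual ν L L) :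
    ∃ (n : ℕ) (T : E ≃L[ℝ] EuclideanSpace ℝ (Fin n)),
      ∀ t, Var[fun x => ⟪t, T x⟫; ν] = ‖t‖ ^ 2 := by
  have hmem : MemLp id 2 ν := IsGaussian.memLp_two_id
  set B := covarianceBilinDual ν
  set n := Module.finrank ℝ (StrongDual ℝ E)
  -- A covariance-orthogonal basis of the dual, once normalised, supplies the whitening coordinates;
  -- they separate points because they span the dual.
  obtain ⟨v, hv⟩ : ∃ v : Module.Basis (Fin n) ℝ (StrongDual ℝ E), B.toBilinForm.IsOrthoᵢ v :=
    LinearMap.BilinForm.exists_orthogonal_basis ⟨fun x y => covarianceBilinDual_comm x y⟩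
  have hvpos : ∀ i, 0 < B (v i) (v i) := fun i => hpos _ (v.ne_zero i)
  let u : Fin n → StrongDual ℝ E := fun i => (√(B (v i) (v i)))⁻¹ • v i
  have hu : ∀ i j, B (u i) (u j) = if i = j then 1 else 0 := by
    intro i j
    simp only [u, map_smul, smul_apply, smul_eq_mul]
    split_ifs with h
    · subst h
      have h1 := Real.mul_self_sqrt (hvpos i).le
      have h2 : √(B (v i) (v i)) ≠ 0 := (Real.sqrt_pos.mpr (hvpos i)).ne'
      field_simp
      rw [sq, h1]
    · have : B (v i) (v j) = 0 := hv h
      rw [this]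
      simp
  let T₀ : E →ₗ[ℝ] EuclideanSpace ℝ (Fin n) :=
    (WithLp.linearEquiv 2 ℝ (Fin n → ℝ)).symm.toLinearMap ∘ₗ
      LinearMap.pi fun i => (u i : E →ₗ[ℝ] ℝ)
  have hT₀ : ∀ x i, T₀ x i = u i x := fun x i => rfl
  have hinj : Function.Injective T₀ := by
    rw [← LinearMap.ker_eq_bot, LinearMap.ker_eq_bot']
    intro x hx
    have h1 : ∀ i, v i x = 0 := by
      intro i
      have h2 : u i x = 0 := by rw [← hT₀, hx]; rfl
      have h3 : √(B (v i) (v i)) ≠ 0 := (Real.sqrt_pos.mpr (hvpos i)).ne'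
      simpa [u, h3] using h2
    by_contra hx0
    obtain ⟨L, hL⟩ := SeparatingDual.exists_ne_zero (R := ℝ) hx0
    refine hL ?_
    have h2 : (∑ i, v.repr L i • v i) x = L x := by rw [v.sum_repr L]
    rw [← h2, sum_apply]
    simp [h1]
  have hdim : Module.finrank ℝ E = Module.finrank ℝ (EuclideanSpace ℝ (Fin n)) := by
    rw [finrank_euclideanSpace_fin]
    have h1 := (LinearMap.toContinuousLinearMap (𝕜 := ℝ) (E := E) (F' := ℝ)).finrank_eq
    exact (Subspace.dual_finrank_eq (K := ℝ) (V := E)).symm.trans h1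
  refine ⟨n, (LinearMap.linearEquivOfInjective T₀ hinj hdim).toContinuousLinearEquiv, fun t => ?_⟩
  have hfun : (fun x => ⟪t, (LinearMap.linearEquivOfInjective T₀ hinj hdim).toContinuousLinearEquiv
      x⟫) = ⇑(∑ i, t i • u i) := by
    ext x
    have h1 : (LinearMap.linearEquivOfInjective T₀ hinj hdim).toContinuousLinearEquiv x = T₀ x :=
      LinearMap.linearEquivOfInjective_apply (hf := hinj) (hdim := hdim) x
    rw [h1, PiLp.inner_apply]
    simp [hT₀, mul_comm]
  rw [hfun, ← covarianceBilinDual_self_eq_variance hmem, EuclideanSpace.real_norm_sq_eq]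
  change B _ _ = _
  simp [hu, sq]

/-- In whitened, recentred coordinates the characteristic function identifies the law as standard
Gaussian. Pulling its density back gives b = 2, c = 0 and the norm ‖T ·‖. -/
lemma IsNormalLaw.isHyperExponentialLaw [Nontrivial E] (vol : Measure E) [vol.IsAddHaarMeasure]
    {ν : Measure E} {m : E} (h : IsNormalLaw vol ν m) : IsHyperExponentialLaw vol ν m := by
  obtain ⟨hG, hac, hm⟩ := h
  obtain ⟨n, T, hT⟩ := exists_equiv_variance_eq ν fun L hL => covarianceBilinDual_self_pos vol hac hL
  set F := EuclideanSpace ℝ (Fin n)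
  set k : ℝ := (2 * Real.pi) ^ (-(Module.finrank ℝ F / 2 : ℝ))
  have hk : 0 < k := by positivity
  let g : F → ℝ≥0∞ := fun y => ENNReal.ofReal (k * Real.exp (-(1 / 2) * ‖y‖ ^ 2))
  have hgm : Measurable g := by fun_prop
  set γ : Measure F := volume.withDensity g
  have hint : Integrable (fun y : F => k * Real.exp (-(1 / 2) * ‖y‖ ^ 2)) := by
    have h1 := GaussianFourier.integrable_cexp_neg_mul_sq_norm_add (V := F) (b := 1 / 2)
      (by norm_num) 0 0
    have h2 := h1.norm
    refine (h2.congr (Eventually.of_forall fun y => ?_)).const_mul k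
    simp only [Complex.norm_exp]
    congr 1
    simp [← Complex.ofReal_pow]
  have hγ : IsFiniteMeasure γ := isFiniteMeasure_withDensity_ofReal hint.2
  let e : F ≃ₜ E := T.symm.toHomeomorph.trans (Homeomorph.addRight m)
  have he : ∀ y, e y = T.symm y + m := fun y => rfl
  have hsymm : ∀ x, e.symm x = T (x - m) := by
    intro x
    rw [Homeomorph.symm_apply_eq, he]
    simp
  have hmap : ν.map e.symm = γ := by
    have : IsFiniteMeasure (ν.map e.symm) := by
      have := Measure.isProbabilityMeasure_map (μ := ν) (f := e.symm)
        e.symm.continuous.measurable.aemeasurable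
      infer_instance
    refine Measure.ext_of_charFun ?_
    ext t
    rw [charFun_withDensity_gaussian]
    have h1 : ν.map e.symm = (ν.map T).map (· + -T m) := by
      rw [Measure.map_map (by fun_prop) T.continuous.measurable]
      congr 1
      ext1 x
      rw [hsymm, Function.comp_apply, map_sub, sub_eq_add_neg]
    have hid : Integrable id ν := IsGaussian.integrable_id
    rw [h1, charFun_map_add_const, IsGaussian.charFun_eq,
      integral_complex_ofReal,
      integral_map T.continuous.measurable.aemeasurable (by fun_prop),
      variance_map (by fun_prop) T.continuous.measurable.aemeasurable]
    have h2 : Var[(fun x => ⟪t, x⟫) ∘ T; ν] = ‖t‖ ^ 2 := hT t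
    have h3 : ∫ x, ⟪t, T x⟫ ∂ν = ⟪t, T m⟫ := by
      have := ((innerSL ℝ t).comp (T : E →L[ℝ] F)).integral_comp_comm hid
      simp only [id] at this
      rw [hm] at this
      exact this
    rw [h2, h3, ← Complex.exp_add, inner_neg_left, real_inner_comm]
    congr 1
    push_cast
    ring
  have hνe : ν = γ.map e := by
    rw [← hmap, Measure.map_map e.continuous.measurable e.symm.continuous.measurable]
    simp
  have hHaar : (Measure.map e (volume : Measure F)).IsAddHaarMeasure := by
    have h1 : (Measure.map T.symm (volume : Measure F)).IsAddHaarMeasure :=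
      T.symm.isAddHaarMeasure_map volume
    have h2 : Measure.map e (volume : Measure F) = Measure.map T.symm (volume : Measure F) := by
      rw [show ⇑e = (fun x => x + m) ∘ T.symm from rfl,
        ← Measure.map_map (by fun_prop) T.symm.continuous.measurable, map_add_right_eq_self]
    rw [h2]
    exact h1
  -- The image of Lebesgue measure is a Haar measure, so it differs from `vol` by a scalar, which
  -- goes into κ.
  set c := Measure.addHaarScalarFactor (Measure.map e (volume : Measure F)) vol
  have hc : Measure.map e (volume : Measure F) = c • vol :=
    Measure.isAddLeftInvariant_eq_smul _ _
  have hc0 : 0 < c := Measure.addHaarScalarFactor_pos_of_isAddHaarMeasure _ _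
  refine ⟨(normSeminorm ℝ F).comp (T : E →ₗ[ℝ] F), c * k, 1 / 2, 2, 0, fun x hx => ?_,
    by positivity, by norm_num, by norm_num, ?_, ?_, fun ξ => ?_, ?_⟩
  · have : ‖T x‖ = 0 := hx
    simpa using this
  · have : 0 < (Module.finrank ℝ E : ℝ) := by exact_mod_cast Module.finrank_pos
    linarith
  · have hn := (continuous_seminorm ((normSeminorm ℝ F).comp (T : E →ₗ[ℝ] F))).measurable
    have hn' := hn.comp (measurable_id.sub_const m)
    have : Measurable fun r : ℝ => c * k * r ^ (0 : ℝ) * Real.exp (-(1 / 2) * r ^ (2 : ℝ)) := by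
      fun_prop
    exact this.comp hn'
  · rw [hyperExpDensity]
    positivity
  · have hdens : ∀ x, hyperExpDensity ((normSeminorm ℝ F).comp (T : E →ₗ[ℝ] F)) m (c * k) (1 / 2)
        2 0 x = c * (k * Real.exp (-(1 / 2) * ‖e.symm x‖ ^ 2)) := by
      intro x
      have h1 : ((normSeminorm ℝ F).comp (T : E →ₗ[ℝ] F)) (x - m) = ‖e.symm x‖ := by
        rw [hsymm]; rfl
      rw [hyperExpDensity, h1, Real.rpow_zero, Real.rpow_two]
      ring
    have hgm' : Measurable fun x => g (e.symm x) := hgm.comp e.symm.continuous.measurable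
    ext S hS
    have hS' : MeasurableSet (e ⁻¹' S) := e.continuous.measurable hS
    rw [hνe, Measure.map_apply e.continuous.measurable hS, withDensity_apply _ hS',
      withDensity_apply _ hS]
    calc ∫⁻ y in e ⁻¹' S, g y = ∫⁻ y in e ⁻¹' S, g (e.symm (e y)) := by simp
      _ = ∫⁻ x in S, g (e.symm x) ∂(Measure.map e volume) :=
        (setLIntegral_map hS hgm' e.continuous.measurable).symm
      _ = c * ∫⁻ x in S, g (e.symm x) ∂vol := by
        rw [hc, Measure.restrict_smul, lintegral_smul_measure]
        rfl
      _ = ∫⁻ x in S, c * g (e.symm x) ∂vol := (lintegral_const_mul _ hgm').symm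
      _ = _ := by
        refine lintegral_congr fun x => ?_
        rw [hdens, ENNReal.ofReal_mul (by positivity), ENNReal.ofReal_coe_nnreal]

end Gaussian

/-! ### Translation invariance. -/

section Translation

variable {E Ω : Type*} [NormedAddCommGroup E] [MeasurableSpace Ω] {P : Measure Ω}

lemma quantError_sub_image (X : Ω → E) (p : ℝ) (Γ : Set E) (m : E) :
    quantError P (fun ω => X ω - m) p ((fun x => x - m) '' Γ) = quantError P X p Γ := by
  have h : ∀ x : E, Metric.infEDist (x - m) ((fun x => x - m) '' Γ) = Metric.infEDist x Γ :=
    fun x => Metric.infEDist_image (IsometryEquiv.subRight m).isometry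
  simp only [quantError, h]

lemma grid_sub (a : ℕ → E) (N : ℕ) (m : E) :
    grid (fun n => a n - m) N = (fun x => x - m) '' grid a N := by
  rw [grid, grid, Set.image_image]

/-- Translations are isometries. This reduces an arbitrary centre to the centre 0, about which
radiality and dilation are formulated. -/
lemma IsGreedySequence.sub {X : Ω → E} {p : ℝ} {a : ℕ → E} (ha : IsGreedySequence P X p a)
    (m : E) : IsGreedySequence P (fun ω => X ω - m) p fun n => a n - m := by
  intro N ξ _
  have key : ∀ η : E, quantError P (fun ω => X ω - m) p (grid (fun n => a n - m) N ∪ {η - m}) =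
      quantError P X p (grid a N ∪ {η}) := fun η => by
    rw [← quantError_sub_image X p (grid a N ∪ {η}) m, Set.image_union, Set.image_singleton,
      grid_sub]
  have h := ha N (Set.mem_univ (ξ + m))
  simp only [Set.mem_ofPred_eq] at h ⊢
  rw [← key, ← key, add_sub_cancel_right] at h
  exact h

lemma isRateOptimal_sub_iff [NormedSpace ℝ E] {X : Ω → E} {q : ℝ} {a : ℕ → E} (m : E) :
    IsRateOptimal P (fun ω => X ω - m) q (fun n => a n - m) ↔ IsRateOptimal P X q a := by
  simp only [IsRateOptimal, grid_sub, quantError_sub_image]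

end Translation

/-! ### The example laws. -/

section Examples

lemma IsHyperExponentialLaw.map_sub {E : Type*} [NormedAddCommGroup E] [NormedSpace ℝ E]
    [MeasurableSpace E] [BorelSpace E] {vol ν : Measure E} [vol.IsAddHaarMeasure] {m : E}
    (h : IsHyperExponentialLaw vol ν m) :
    IsHyperExponentialLaw vol (ν.map fun x => x - m) 0 := by
  obtain ⟨n₀, κ, a, b, c, hn₀, hκ, ha, hb, hc, hm, hpos, hν⟩ := h
  have e : ∀ x, hyperExpDensity n₀ 0 κ a b c (x - m) = hyperExpDensity n₀ m κ a b c x := fun x => by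
    simp [hyperExpDensity]
  have e' : ∀ x, hyperExpDensity n₀ 0 κ a b c x = hyperExpDensity n₀ m κ a b c (x + m) := fun x => by
    simp [hyperExpDensity]
  have hm0 : Measurable (hyperExpDensity n₀ 0 κ a b c) := by
    rw [funext e']
    exact hm.comp (measurable_add_const m)
  refine ⟨n₀, κ, a, b, c, hn₀, hκ, ha, hb, hc, hm0, fun ξ => by rw [e']; exact hpos _, ?_⟩
  have hs : Measurable fun x : E => x - m := measurable_sub_const m
  ext S hS
  rw [Measure.map_apply hs hS, hν, withDensity_apply _ (hs hS), withDensity_apply _ hS]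
  simp_rw [← e]
  rw [← setLIntegral_map hS hm0.ennreal_ofReal hs, map_sub_right_eq_self]

lemma IsLaplaceLaw.isHyperExponentialLaw {E : Type*} [NormedAddCommGroup E] [NormedSpace ℝ E]
    [FiniteDimensional ℝ E] [MeasurableSpace E] [Nontrivial E] {vol ν : Measure E} {m : E}
    (h : IsLaplaceLaw vol ν m) : IsHyperExponentialLaw vol ν m := by
  obtain ⟨n₀, κ, a, hn₀, hκ, ha, hφ⟩ := h
  refine ⟨n₀, κ, a, 1, 0, hn₀, hκ, ha, one_pos, ?_, ?_⟩
  · rw [neg_lt_zero]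
    exact_mod_cast Module.finrank_pos
  · have : hyperExpDensity n₀ m κ a 1 0 = fun ξ => κ * Real.exp (-a * n₀ (ξ - m)) := by
      ext ξ
      rw [hyperExpDensity, Real.rpow_zero, Real.rpow_one, mul_one]
    rwa [this]

variable {E : Type*} [NormedAddCommGroup E] [NormedSpace ℝ E] [FiniteDimensional ℝ E]
  [MeasurableSpace E] [BorelSpace E]

lemma IsExampleLaw.isHyperExponentialLaw [Nontrivial E] {vol ν : Measure E}
    [vol.IsAddHaarMeasure] {m : E} (h : IsExampleLaw vol ν m) : IsHyperExponentialLaw vol ν m := by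
  rcases h with h | h | h
  · exact h
  · exact h.isHyperExponentialLaw
  · exact h.isHyperExponentialLaw vol

/-- A centred hyper-exponential law satisfies the hypotheses of the criterion. -/
lemma IsHyperExponentialLaw.criterion [Nontrivial E] {vol : Measure E} [vol.IsAddHaarMeasure]
    {Ω : Type*} [MeasurableSpace Ω] {P : Measure Ω} [IsProbabilityMeasure P] {X : Ω → E}
    (hX : Measurable X) {p q : ℝ} (hp : 0 < p) (h : IsHyperExponentialLaw vol (P.map X) 0)
    (hq : 0 < q) (hqp : q < p + Module.finrank ℝ E) :
    (∃ δ : ℝ, 0 < δ ∧ MemLp X (ENNReal.ofReal (p + δ)) P) ∧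
      ∃ φ : E → ℝ, IsDensity vol (P.map X) φ ∧ IsEssentiallyRadial φ ∧
        HasDilatedMoment (P.map X) φ (q / (p + Module.finrank ℝ E)) := by
  obtain ⟨n₀, κ, a, b, c, hn₀, hκ, ha, hb, -, hφ⟩ := h
  have hprob : IsProbabilityMeasure (P.map X) := Measure.isProbabilityMeasure_map hX.aemeasurable
  refine ⟨⟨1, one_pos, ?_⟩, _, hφ, isEssentiallyRadial_hyperExp hn₀ hκ ha hb,
    hasDilatedMoment_hyperExp hn₀ hκ ha hb hφ (by positivity) ?_⟩
  · exact (memLp_map_measure_iff aestronglyMeasurable_id hX.aemeasurable).mp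
      (memLp_id_of_hyperExp hn₀ hκ ha hb hφ (by positivity : 0 < p + 1))
  · rwa [div_lt_one (by positivity)]

end Examples

end GreedyQuantization

theorem mainTheorem6
    {E : Type*} [NormedAddCommGroup E] [NormedSpace ℝ E] [FiniteDimensional ℝ E] [Nontrivial E]
    [MeasurableSpace E] [BorelSpace E] (vol : Measure E) [vol.IsAddHaarMeasure]
    {Ω : Type*} [MeasurableSpace Ω] (P : Measure Ω) [IsProbabilityMeasure P]
    (X : Ω → E) (hX : Measurable X) (p : ℝ) (hp : 0 < p) :
    -- the criterion
    (∀ (q : ℝ) (φ : E → ℝ), 0 < q →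
      (∃ δ : ℝ, 0 < δ ∧ MemLp X (ENNReal.ofReal (p + δ)) P) →
      GreedyQuantization.IsDensity vol (P.map X) φ →
      GreedyQuantization.IsEssentiallyRadial φ →
      GreedyQuantization.HasDilatedMoment (P.map X) φ (q / (p + Module.finrank ℝ E)) →
      ∀ a : ℕ → E, GreedyQuantization.IsGreedySequence P X p a →
        GreedyQuantization.IsRateOptimal P X q a) ∧
    -- the centred hyper-exponential, Laplace and normal laws satisfy its hypotheses
    (GreedyQuantization.IsExampleLaw vol (P.map X) 0 →
      ∀ q : ℝ, 0 < q → q < p + Module.finrank ℝ E →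
        (∃ δ : ℝ, 0 < δ ∧ MemLp X (ENNReal.ofReal (p + δ)) P) ∧
        ∃ φ : E → ℝ, GreedyQuantization.IsDensity vol (P.map X) φ ∧
          GreedyQuantization.IsEssentiallyRadial φ ∧
          GreedyQuantization.HasDilatedMoment (P.map X) φ (q / (p + Module.finrank ℝ E))) ∧
    -- its conclusion holds for these laws, centred or not
    (∀ m : E, GreedyQuantization.IsExampleLaw vol (P.map X) m →
      ∀ q : ℝ, 0 < q → q < p + Module.finrank ℝ E →
        ∀ a : ℕ → E, GreedyQuantization.IsGreedySequence P X p a →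
          GreedyQuantization.IsRateOptimal P X q a) := by
  refine ⟨fun q φ hq ⟨δ, hδ, hLp⟩ hφ hrad hmom a ha =>
    ha.isRateOptimal vol hX hp hq hδ hLp hφ hrad hmom,
    fun h q hq hqp => h.isHyperExponentialLaw.criterion hX hp hq hqp,
    fun m h q hq hqp a ha => ?_⟩
  -- The criterion is applied to the centred vector X - m and the shifted sequence, then transported
  -- back.
  have hX' : Measurable fun ω => X ω - m := hX.sub_const m
  have hlaw : GreedyQuantization.IsHyperExponentialLaw vol (P.map fun ω => X ω - m) 0 := by
    have h1 := h.isHyperExponentialLaw.map_sub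
    rwa [Measure.map_map (measurable_sub_const m) hX] at h1
  obtain ⟨⟨δ, hδ, hLp⟩, φ, hφ, hrad, hmom⟩ := hlaw.criterion hX' hp hq hqp
  exact (GreedyQuantization.isRateOptimal_sub_iff m).mp
    ((ha.sub m).isRateOptimal vol hX' hp hq hδ hLp hφ hrad hmom)
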